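/- Let $d\ge 1$, let $a,\phi:\mathbb{R}^d\to[0,\infty)$ be measurable and even, with $\int_{\mathbb{R}^d} a(x)\,dx<\infty$ and $\int_{\mathbb{R}^d}(1-e^{-\phi(x)})\,dx<\infty$. Let $\Gamma_0=\bigsqcup_{n\ge 0}\Gamma^{(n)}$ be the space of finite subsets $\eta$ of $\mathbb{R}^d$, where $\Gamma^{(n)}$, the set of $n$-point subsets, carries the quotient topology from the $n$-tuples of distinct points, and $\Gamma_0$ carries the disjoint union topology and its Borel $\sigma$-field. Let $\mathcal{M}(\Gamma_0)$ be the Banach space of finite signed measures on $\Gamma_0$ with the total variation norm, and $\mathcal{M}_+(\Gamma_0)$ its cone of positive measures. A $\Gamma_0$-state is a probability measure on $\Gamma_0$. For $\eta\in\Gamma_0$ and measurable $A\subset\Gamma_0$ put $$\Omega(A,\eta)=\sum_{x\in\eta}\int_{\mathbb{R}^d}a(x-y)\exp\Bigl(-\sum_{z\in\eta}\phi(y-z)\Bigr)\mathbb{1}_A\bigl((\eta\setminus\{x\})\cup\{y\}\bigr)\,dy,$$ $$(L^*\mu)(A)=-\int_{\Gamma_0}\Omega(\Gamma_0,\eta)\mathbb{1}_A(\eta)\,\mu(d\eta)+\int_{\Gamma_0}\Omega(A,\eta)\,\mu(d\eta),$$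 with $\mathrm{Dom}(L^*)=\{\mu\in\mathcal{M}(\Gamma_0):\ \Omega(\Gamma_0,\cdot)\mu\in\mathcal{M}(\Gamma_0)\}$. Then $L^*$ is a well-defined operator from $\mathrm{Dom}(L^*)$ to $\mathcal{M}(\Gamma_0)$, and its closure $\overline{L^*}$ generates a stochastic $C_0$-semigroup $(S_\mu(t))_{t\ge 0}$ on $\mathcal{M}(\Gamma_0)$, i.e. a $C_0$-semigroup of bounded operators that leaves $\mathcal{M}_+(\Gamma_0)$ invariant and satisfies $\|S_\mu(t)\mu\|=1$ for all $\mu\in\mathcal{M}_+(\Gamma_0)$ with $\|\mu\|=1$. Consider the Fokker–Planck equation $$\frac{d}{dt}\mu_t=\overline{L^*}\mu_t,\qquad \mu_t|_{t=0}=\mu_0 .$$ (i) For every $\Gamma_0$-state $\mu_0$, the measures $\mu_t=S_\mu(t)\mu_0$, $t\ge0$, are probability measures and form the unique mild solution on $[0,\infty)$, i.e. the unique continuous $\mu:[0,\infty)\to\mathcal{M}(\Gamma_0)$ with $\int_0^t\mu_s\,ds\in\mathrm{Dom}(\overline{L^*})$ and $\mu_t=\mu_0+\overline{L^*}\int_0^t\mu_s\,ds$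 for all $t\ge 0$. (ii) If moreover $\mu_0\in\mathrm{Dom}(\overline{L^*})$, then $\mu_t=S_\mu(t)\mu_0$ is the unique classical solution on $[0,\infty)$, i.e. the unique solution that is continuous on $[0,\infty)$, continuously differentiable on $(0,\infty)$, and lies in $\mathrm{Dom}(\overline{L^*})$ for all $t\geq 0$. (iii) Let $b(\eta)=\delta(|\eta|)$ with $\delta:\{0,1,2,\dots\}\to[0,\infty)$ satisfy $b(\eta)\ge\varepsilon\,\Omega(\Gamma_0,\eta)$ for some $\varepsilon>0$ and all $\eta\in\Gamma_0$. Then each $S_\mu(t)$ leaves $\mathcal{M}_{b,+}(\Gamma_0)=\{\mu\in\mathcal{M}_+(\Gamma_0):\int b\,d\mu<\infty\}$ invariant. If the $\Gamma_0$-state $\mu_0$ belongs to $\mathcal{M}_{b,+}(\Gamma_0)$, then $\mu_t=S_\mu(t)\mu_0$ lies in $\mathrm{Dom}(L^*)$ for all $t\geq 0$ and is a classical solution of the equation with $L^*$ itself in place of $\overline{L^*}$. -/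

import Mathlib

open MeasureTheory Set Filter Topology
open scoped NNReal ENNReal

noncomputable section

namespace Kawasaki

/-! ### The Banach space of signed measures -/

/-- The total variation norm on the space of (finite) signed measures. -/
instance signedMeasureNorm {X : Type*} [MeasurableSpace X] : Norm (SignedMeasure X) where
  norm μ := μ.totalVariation.real univ

theorem norm_signedMeasure_def {X : Type*} [MeasurableSpace X] (μ : SignedMeasure X) :
    ‖μ‖ = μ.totalVariation.real univ := rfl

theorem signedMeasure_core {X : Type*} [MeasurableSpace X] :
    NormedSpace.Core ℝ (SignedMeasure X) where
  norm_nonneg μ := measureReal_nonneg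
  norm_smul c μ := by
    simp only [norm_signedMeasure_def, SignedMeasure.totalVariation_eq_variation]
    rw [VectorMeasure.variation_smul]
    simp [measureReal_def]
  norm_triangle μ ν := by
    have hfin : ∀ ρ : SignedMeasure X, ρ.variation univ ≠ ∞ := fun ρ => by
      rw [← SignedMeasure.totalVariation_eq_variation]; exact measure_ne_top _ _
    simp only [norm_signedMeasure_def, SignedMeasure.totalVariation_eq_variation, measureReal_def]
    rw [← ENNReal.toReal_add (hfin μ) (hfin ν)]
    refine ENNReal.toReal_mono (ENNReal.add_ne_top.2 ⟨hfin μ, hfin ν⟩) ?_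
    exact (VectorMeasure.variation_add_le (μ := μ) (ν := ν)) univ
  norm_eq_zero_iff μ := by
    constructor
    · intro h
      ext i hi
      have h1 := SignedMeasure.norm_le_totalVariation μ i
      have h2 : μ.totalVariation.real i ≤ μ.totalVariation.real univ :=
        measureReal_mono (subset_univ i)
      rw [norm_signedMeasure_def] at h
      have h3 : ‖μ i‖ = 0 := le_antisymm (by linarith) (norm_nonneg _)
      simpa using h3
    · rintro rfl
      rw [norm_signedMeasure_def, SignedMeasure.totalVariation_zero]
      simp

instance signedMeasureNormedAddCommGroup {X : Type*} [MeasurableSpace X] :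
    NormedAddCommGroup (SignedMeasure X) :=
  NormedAddCommGroup.ofCore signedMeasure_core

instance signedMeasureNormedSpace {X : Type*} [MeasurableSpace X] :
    NormedSpace ℝ (SignedMeasure X) :=
  NormedSpace.ofCore signedMeasure_core

/-! ### Semigroups and Cauchy problems in a normed space

Linear operators, which need not be everywhere defined, are given by their graphs. -/

/-- A `C₀`-semigroup of bounded operators. -/
structure IsC0Semigroup {V : Type*} [NormedAddCommGroup V] [NormedSpace ℝ V]
    (S : ℝ≥0 → V →L[ℝ] V) : Prop where
  map_zero : S 0 = ContinuousLinearMap.id ℝ V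
  map_add : ∀ s t, S (s + t) = (S s).comp (S t)
  tendsto_zero : ∀ v, Tendsto (fun t => S t v) (𝓝[>] 0) (𝓝 v)

/-- The graph of the generator of a semigroup: the pairs `(v, w)` such that
`(S h v - v) / h → w` as `h → 0+`. -/
def generatorGraph {V : Type*} [NormedAddCommGroup V] [NormedSpace ℝ V]
    (S : ℝ≥0 → V →L[ℝ] V) : Set (V × V) :=
  {p | Tendsto (fun h : ℝ≥0 => (h : ℝ)⁻¹ • (S h p.1 - p.1)) (𝓝[>] 0) (𝓝 p.2)}

/-- `u` is a classical solution on `[0, ∞)` of `u' = A u`, `u 0 = u₀`, where `G` is the graph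
of `A`: it is continuous on `[0, ∞)`, continuously differentiable on `(0, ∞)`, lies in the domain
of `A`, and solves the equation. Only the values of `u` on `[0, ∞)` matter. -/
structure IsClassicalSolution {V : Type*} [NormedAddCommGroup V] [NormedSpace ℝ V]
    (G : Set (V × V)) (u₀ : V) (u : ℝ → V) : Prop where
  initial : u 0 = u₀
  continuousOn : ContinuousOn u (Ici 0)
  differentiableAt : ∀ t, 0 < t → DifferentiableAt ℝ u t
  continuousOn_deriv : ContinuousOn (deriv u) (Ioi 0)
  mem_domain : ∀ t, 0 ≤ t → ∃ w, (u t, w) ∈ G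
  equation : ∀ t, 0 < t → (u t, deriv u t) ∈ G

/-- `u` is a mild solution on `[0, ∞)` of `u' = A u`, `u 0 = u₀`, where `G` is the graph of `A`:
it is continuous, `∫₀ᵗ u` lies in the domain of `A`, and `u t = u₀ + A ∫₀ᵗ u`. -/
structure IsMildSolution {V : Type*} [NormedAddCommGroup V] [NormedSpace ℝ V]
    (G : Set (V × V)) (u₀ : V) (u : ℝ → V) : Prop where
  continuousOn : ContinuousOn u (Ici 0)
  equation : ∀ t, 0 ≤ t → (∫ s in (0 : ℝ)..t, u s, u t - u₀) ∈ G

/-- A stochastic semigroup on the space of signed measures: a `C₀`-semigroup which leaves the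
cone of positive measures invariant and preserves the norm of positive measures of norm one. -/
structure IsStochasticSemigroup {X : Type*} [MeasurableSpace X]
    (S : ℝ≥0 → SignedMeasure X →L[ℝ] SignedMeasure X) : Prop extends IsC0Semigroup S where
  nonneg : ∀ t μ, 0 ≤ μ → 0 ≤ S t μ
  norm_eq_one : ∀ t μ, 0 ≤ μ → ‖μ‖ = 1 → ‖S t μ‖ = 1

/-! ### Finite configurations -/

/-- The space `Γ₀` of finite configurations, i.e. of finite subsets of `ℝᵈ`. -/
@[ext]
structure FinConf (d : ℕ) where
  /-- the set of points of the configuration -/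
  pts : Finset (EuclideanSpace ℝ (Fin d))

/-- The configuration `{x₁, …, xₙ}` of an `n`-tuple of distinct points. -/
def ofTuple {d : ℕ} (n : ℕ)
    (x : {x : Fin n → EuclideanSpace ℝ (Fin d) // Function.Injective x}) : FinConf d :=
  ⟨Finset.univ.map ⟨x.1, x.2⟩⟩

/-- The topology of the disjoint union of the sets of `n`-point configurations, each of which is
the symmetrization of the set of `n`-tuples of distinct points: a set is open iff, for every `n`,
its preimage under `ofTuple n` is open. -/
instance finConfTopology (d : ℕ) : TopologicalSpace (FinConf d) :=
  ⨆ n : ℕ, TopologicalSpace.coinduced (ofTuple n) inferInstance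

/-- The Borel `σ`-field of `Γ₀`. -/
instance finConfMeasurableSpace (d : ℕ) : MeasurableSpace (FinConf d) := borel (FinConf d)

instance finConfBorelSpace (d : ℕ) : BorelSpace (FinConf d) := ⟨rfl⟩

open Classical in
/-- The configuration `η \ x ∪ y`. -/
def jump {d : ℕ} (η : FinConf d) (x y : EuclideanSpace ℝ (Fin d)) : FinConf d :=
  ⟨insert y (η.pts.erase x)⟩

/-! ### The Kawasaki dynamics -/

/-- The energy `E^φ(y, η) = ∑_{z ∈ η} φ(y - z)`. -/
def energy {d : ℕ} (φ : EuclideanSpace ℝ (Fin d) → ℝ) (y : EuclideanSpace ℝ (Fin d))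
    (η : FinConf d) : ℝ :=
  ∑ z ∈ η.pts, φ (y - z)

/-- The jump kernel
`Ω(A, η) = ∑_{x ∈ η} ∫ a(x - y) exp(-E^φ(y, η)) 𝟙_A(η \ x ∪ y) dy`. -/
def Omega {d : ℕ} (a φ : EuclideanSpace ℝ (Fin d) → ℝ) (A : Set (FinConf d))
    (η : FinConf d) : ℝ :=
  ∑ x ∈ η.pts, ∫ y, a (x - y) * Real.exp (-energy φ y η) *
    A.indicator (fun _ => (1 : ℝ)) (jump η x y)

/-- The domain of `L*`: the signed measures `μ` for which `Ω(Γ₀, ·) μ` is a signed measure of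
bounded variation. -/
def domLstar {d : ℕ} (a φ : EuclideanSpace ℝ (Fin d) → ℝ) : Set (SignedMeasure (FinConf d)) :=
  {μ | μ.Integrable (Omega a φ univ)}

/-- The graph of `L*`: the pairs `(μ, ν)` with `μ` in the domain and, for all measurable `A`,
`ν(A) = -∫ Ω(Γ₀, η) 𝟙_A(η) μ(dη) + ∫ Ω(A, η) μ(dη)`. -/
def graphLstar {d : ℕ} (a φ : EuclideanSpace ℝ (Fin d) → ℝ) :
    Set (SignedMeasure (FinConf d) × SignedMeasure (FinConf d)) :=
  {p | p.1 ∈ domLstar a φ ∧ ∀ A, MeasurableSet A →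
    p.2 A = -(∫ᵛ η, Omega a φ univ η * A.indicator (fun _ => (1 : ℝ)) η ∂•p.1) +
      ∫ᵛ η, Omega a φ A η ∂•p.1}

/-- The cone `M_{b,+}(Γ₀)` of positive measures `μ` with `∫ b dμ < ∞`. -/
def coneMb {d : ℕ} (b : FinConf d → ℝ) : Set (SignedMeasure (FinConf d)) :=
  {μ | 0 ≤ μ ∧ μ.Integrable b}

end Kawasaki

end

noncomputable section

open ProbabilityTheory

namespace Kawasaki

/-!
A jump preserves the number of particles almost surely, so `L*` is block diagonal with respect to
`μ = ∑ₙ μ|_{|η| = n}`, and the total variation norm makes this an `ℓ¹`-direct sum. On the `n`-th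
block the jump rate is bounded by some `C`; waiting at rate `C - Ω(Γ₀, η)` turns `Ω` into a kernel
of constant mass `C` (uniformization), and the block of `L*` becomes `K - C` with `K` a positive
bounded operator multiplying the total mass by `C`. Hence `exp (t (K - C))` is positive and
preserves mass. These exponentials are contractions, so they add up to a stochastic semigroup whose
generator is the maximal block sum, and finite sums of blocks show that it is the closure of `L*`.
Since the law of the particle number does not change, neither does `∫ b dμ` for `b` a function of
that number.
-/

section SignedMeasures

variable {X : Type*} [MeasurableSpace X]

theorem exists_vectorMeasure_of_tendstoUniformly {M ι : Type*} [NormedAddCommGroup M]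
    {l : Filter ι} [l.NeBot] {u : ι → VectorMeasure X M} {ν : Set X → M}
    (h : TendstoUniformly (fun i A => u i A) ν l) : ∃ ν' : VectorMeasure X M, ⇑ν' = ν := by
  have hν : ∀ A, Tendsto (fun i => u i A) l (𝓝 (ν A)) := h.tendsto_at
  refine ⟨⟨ν, tendsto_nhds_unique (hν ∅) (by simp),
    fun A hA => tendsto_nhds_unique (hν A) (by simp [hA]), fun f hf hd => ?_⟩, rfl⟩
  have hsum (μ : VectorMeasure X M) (s : Finset ℕ) : ∑ n ∈ s, μ (f n) = μ (⋃ n ∈ s, f n) :=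
    (μ.of_biUnion_finset (fun i _ j _ hij => hd hij) (fun n _ => hf n)).symm
  have hsum_lim (s : Finset ℕ) : ∑ n ∈ s, ν (f n) = ν (⋃ n ∈ s, f n) :=
    tendsto_nhds_unique (tendsto_finsetSum s fun n _ => hν (f n))
      (by simpa only [hsum] using hν (⋃ n ∈ s, f n))
  have hunif : TendstoUniformly (fun i (s : Finset ℕ) => ∑ n ∈ s, u i (f n))
      (fun s => ∑ n ∈ s, ν (f n)) l := by
    simp only [hsum, hsum_lim]
    exact h.comp fun s : Finset ℕ => ⋃ n ∈ s, f n
  exact (hunif.tendstoUniformlyOnFilter.mono_right le_top).tendsto_of_eventually_tendsto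
    (Eventually.of_forall fun i => (u i).m_iUnion hf hd) (hν _)

instance isFiniteMeasure_variation (μ : SignedMeasure X) : IsFiniteMeasure μ.variation := by
  rw [← SignedMeasure.totalVariation_eq_variation, SignedMeasure.totalVariation]
  infer_instance

theorem norm_eq_variation (μ : SignedMeasure X) : ‖μ‖ = μ.variation.real univ := by
  rw [norm_signedMeasure_def, SignedMeasure.totalVariation_eq_variation]

theorem norm_apply_le_norm (μ : SignedMeasure X) (A : Set X) : ‖μ A‖ ≤ ‖μ‖ :=
  (SignedMeasure.norm_le_totalVariation μ A).trans (measureReal_mono (subset_univ A))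

theorem norm_le_two_mul_of_forall_norm_apply_le {μ : SignedMeasure X} {C : ℝ}
    (h : ∀ A, ‖μ A‖ ≤ C) : ‖μ‖ ≤ 2 * C := by
  obtain ⟨s, hs, hpos, hneg, hpos_eq, hneg_eq⟩ := μ.toJordanDecomposition_spec
  have posPart_univ : μ.toJordanDecomposition.posPart.real univ = μ s := by
    rw [hpos_eq, measureReal_def, SignedMeasure.toMeasureOfZeroLE_apply _ _ _ MeasurableSet.univ]
    simp
  have negPart_univ : μ.toJordanDecomposition.negPart.real univ = -μ sᶜ := by
    rw [hneg_eq, measureReal_def, SignedMeasure.toMeasureOfLEZero_apply _ _ _ MeasurableSet.univ]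
    simp
  rw [norm_signedMeasure_def, SignedMeasure.totalVariation, measureReal_add_apply,
    posPart_univ, negPart_univ]
  linarith [abs_le.1 (h s), abs_le.1 (h sᶜ)]

/-- Evaluation of signed measures at a set, as a continuous linear functional. -/
def evalCLM (A : Set X) : SignedMeasure X →L[ℝ] ℝ :=
  LinearMap.mkContinuous
    { toFun μ := μ A
      map_add' μ ν := by simp
      map_smul' c μ := by simp } 1
    fun μ => by simpa using norm_apply_le_norm μ A

@[simp]
theorem evalCLM_apply (A : Set X) (μ : SignedMeasure X) : evalCLM A μ = μ A := rfl

instance completeSpace_signedMeasure : CompleteSpace (SignedMeasure X) := by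
  refine Metric.complete_of_cauchySeq_tendsto fun u hu => ?_
  have heval (A : Set X) : CauchySeq fun n => u n A := hu.map (evalCLM A).uniformContinuous
  choose ν hν using fun A => cauchySeq_tendsto_of_complete (heval A)
  have hcauchy : UniformCauchySeqOn (fun n A => u n A) atTop univ := by
    refine Metric.uniformCauchySeqOn_iff.2 fun ε hε => ?_
    obtain ⟨N, hN⟩ := Metric.cauchySeq_iff.1 hu ε hε
    refine ⟨N, fun m hm n hn A _ => lt_of_le_of_lt ?_ (hN m hm n hn)⟩
    simpa [dist_eq_norm] using norm_apply_le_norm (u m - u n) A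
  have hunif : TendstoUniformly (fun n A => u n A) ν atTop :=
    tendstoUniformlyOn_univ.1 (hcauchy.tendstoUniformlyOn_of_tendsto fun A _ => hν A)
  obtain ⟨ν, rfl⟩ := exists_vectorMeasure_of_tendstoUniformly hunif
  refine ⟨ν, Metric.tendsto_atTop.2 fun ε hε => ?_⟩
  obtain ⟨N, hN⟩ := eventually_atTop.1 (Metric.tendstoUniformly_iff.1 hunif (ε / 3) (by positivity))
  refine ⟨N, fun n hn => ?_⟩
  have hle : ‖u n - ν‖ ≤ 2 * (ε / 3) := norm_le_two_mul_of_forall_norm_apply_le fun A => by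
    simpa [dist_eq_norm'] using (hN n hn A).le
  rw [dist_eq_norm]
  linarith

theorem nonneg_iff {μ : SignedMeasure X} : 0 ≤ μ ↔ ∀ A, MeasurableSet A → 0 ≤ μ A := by
  simp [VectorMeasure.le_iff]

instance : IsOrderedAddMonoid (SignedMeasure X) where
  add_le_add_left _ _ h ρ := add_le_add_left h ρ

instance : PosSMulMono ℝ (SignedMeasure X) :=
  .of_smul_nonneg fun _ hc _ hμ => nonneg_iff.2 fun A hA => mul_nonneg hc (nonneg_iff.1 hμ A hA)

instance : OrderClosedTopology (SignedMeasure X) where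
  isClosed_le' := by
    simp only [VectorMeasure.le_iff, ofPred_forall]
    exact isClosed_iInter fun A => isClosed_iInter fun _ =>
      isClosed_le ((evalCLM A).continuous.comp continuous_fst)
        ((evalCLM A).continuous.comp continuous_snd)

theorem exists_eq_toSignedMeasure {μ : SignedMeasure X} (h : 0 ≤ μ) :
    ∃ m : Measure X, ∃ _ : IsFiniteMeasure m, μ = m.toSignedMeasure := by
  have h' : 0 ≤[univ] μ := (VectorMeasure.le_restrict_univ_iff_le 0 μ).2 h
  exact ⟨μ.toMeasureOfZeroLE univ MeasurableSet.univ h', inferInstance,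
    (SignedMeasure.toMeasureOfZeroLE_toSignedMeasure μ h').symm⟩

theorem norm_toSignedMeasure (m : Measure X) [IsFiniteMeasure m] :
    ‖m.toSignedMeasure‖ = m.real univ := by
  rw [norm_eq_variation, Measure.variation_toSignedMeasure]

theorem norm_eq_apply_univ_of_nonneg {μ : SignedMeasure X} (h : 0 ≤ μ) : ‖μ‖ = μ univ := by
  obtain ⟨m, _, rfl⟩ := exists_eq_toSignedMeasure h
  rw [norm_toSignedMeasure, Measure.toSignedMeasure_apply_measurable MeasurableSet.univ]

theorem exists_nonneg_sub_nonneg_eq (μ : SignedMeasure X) :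
    ∃ μ₁ μ₂ : SignedMeasure X, 0 ≤ μ₁ ∧ 0 ≤ μ₂ ∧ μ₁ - μ₂ = μ ∧ ‖μ₁‖ + ‖μ₂‖ = ‖μ‖ := by
  refine ⟨_, _, Measure.zero_le_toSignedMeasure μ.toJordanDecomposition.posPart,
    Measure.zero_le_toSignedMeasure μ.toJordanDecomposition.negPart,
    μ.toSignedMeasure_toJordanDecomposition, ?_⟩
  rw [norm_toSignedMeasure, norm_toSignedMeasure, norm_signedMeasure_def,
    SignedMeasure.totalVariation, measureReal_add_apply]

theorem norm_le_one_of_nonneg_of_apply_univ {T : SignedMeasure X →L[ℝ] SignedMeasure X}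
    (hT : ∀ μ, 0 ≤ μ → 0 ≤ T μ) (hmass : ∀ μ, T μ univ = μ univ) : ‖T‖ ≤ 1 := by
  refine T.opNorm_le_bound zero_le_one fun μ => ?_
  obtain ⟨μ₁, μ₂, h₁, h₂, rfl, hnorm⟩ := exists_nonneg_sub_nonneg_eq μ
  have norm_eq {ν : SignedMeasure X} (h : 0 ≤ ν) : ‖T ν‖ = ‖ν‖ := by
    rw [norm_eq_apply_univ_of_nonneg (hT ν h), hmass, norm_eq_apply_univ_of_nonneg h]
  calc ‖T (μ₁ - μ₂)‖ = ‖T μ₁ - T μ₂‖ := by rw [map_sub]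
    _ ≤ ‖T μ₁‖ + ‖T μ₂‖ := norm_sub_le _ _
    _ = 1 * ‖μ₁ - μ₂‖ := by rw [norm_eq h₁, norm_eq h₂, hnorm, one_mul]

theorem integral_toSignedMeasure_eq {m : Measure X} [IsFiniteMeasure m] (f : X → ℝ) :
    ∫ᵛ x, f x ∂•m.toSignedMeasure = ∫ x, f x ∂m := by
  rw [← VectorMeasure.integral_toSignedMeasure]
  congr 1
  ext
  simp

theorem integral_nonneg_of_nonneg {μ : SignedMeasure X} (h : 0 ≤ μ) {f : X → ℝ}
    (hf : ∀ x, 0 ≤ f x) : 0 ≤ ∫ᵛ x, f x ∂•μ := by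
  obtain ⟨m, _, rfl⟩ := exists_eq_toSignedMeasure h
  rw [integral_toSignedMeasure_eq]
  exact integral_nonneg hf

/-- Restriction of signed measures to a set, as a bounded operator. -/
def restrictCLM (A : Set X) : SignedMeasure X →L[ℝ] SignedMeasure X :=
  LinearMap.mkContinuous
    { toFun μ := μ.restrict A
      map_add' μ ν := μ.restrict_add ν A
      map_smul' c _ := VectorMeasure.restrict_smul c } 1
    fun μ => by
      rw [one_mul, norm_eq_variation, norm_eq_variation]
      exact ENNReal.toReal_mono (measure_ne_top _ _)
        ((VectorMeasure.variation_restrict_le.trans Measure.restrict_le_self) univ)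

@[simp]
theorem restrictCLM_apply (A : Set X) (μ : SignedMeasure X) :
    restrictCLM A μ = μ.restrict A := rfl

theorem norm_restrict {A : Set X} (hA : MeasurableSet A) (μ : SignedMeasure X) :
    ‖μ.restrict A‖ = μ.variation.real A := by
  rw [norm_eq_variation, VectorMeasure.variation_restrict hA, measureReal_restrict_apply_univ]

section Partition

variable {ι : Type*} [Countable ι] {A : ι → Set X}

theorem hasSum_measureReal (m : Measure X) [IsFiniteMeasure m] (hA : ∀ i, MeasurableSet (A i))
    (hd : Pairwise (Function.onFun Disjoint A)) :
    HasSum (fun i => m.real (A i)) (m.real (⋃ i, A i)) := by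
  simpa only [Measure.toSignedMeasure_apply_measurable (hA _),
    Measure.toSignedMeasure_apply_measurable (MeasurableSet.iUnion hA)]
    using m.toSignedMeasure.hasSum_of_disjoint_iUnion hA hd

theorem hasSum_norm_restrict (hA : ∀ i, MeasurableSet (A i))
    (hd : Pairwise (Function.onFun Disjoint A)) (hu : ⋃ i, A i = univ) (μ : SignedMeasure X) :
    HasSum (fun i => ‖μ.restrict (A i)‖) ‖μ‖ := by
  simp only [norm_restrict (hA _), norm_eq_variation μ, ← hu]
  exact hasSum_measureReal _ hA hd

theorem hasSum_restrict (hA : ∀ i, MeasurableSet (A i))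
    (hd : Pairwise (Function.onFun Disjoint A)) (hu : ⋃ i, A i = univ) (μ : SignedMeasure X) :
    HasSum (fun i => μ.restrict (A i)) μ := by
  obtain ⟨ν, hν⟩ := (hasSum_norm_restrict hA hd hu μ).summable.of_norm
  suffices μ = ν by rwa [this] at hν ⊢
  ext B hB
  refine HasSum.unique ?_ (hν.mapL (evalCLM B))
  have hBA := μ.hasSum_of_disjoint_iUnion (fun i => hB.inter (hA i))
    fun i j hij => (hd hij).mono inter_subset_right inter_subset_right
  rw [← inter_iUnion, hu, inter_univ] at hBA
  simpa only [evalCLM_apply, restrictCLM_apply, VectorMeasure.restrict_apply _ (hA _) hB] using hBA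

end Partition

end SignedMeasures

section Kernels

variable {X Y : Type*} [MeasurableSpace X] [MeasurableSpace Y]

theorem measurable_measureReal_kernel (κ : Kernel X Y) {A : Set Y} (hA : MeasurableSet A) :
    Measurable fun x => (κ x).real A :=
  (κ.measurable_coe hA).ennreal_toReal

theorem integrable_measureReal_kernel_of_mul_le (κ : Kernel X Y) {μ : SignedMeasure X}
    {b : X → ℝ} (hb : μ.Integrable b) {ε : ℝ} (hε : 0 < ε) (h : ∀ x, ε * (κ x).real univ ≤ b x) :
    μ.Integrable fun x => (κ x).real univ := by
  refine Integrable.mono' (Integrable.const_mul hb ε⁻¹)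
    (measurable_measureReal_kernel κ MeasurableSet.univ).aestronglyMeasurable
    (Eventually.of_forall fun x => ?_)
  rw [Real.norm_of_nonneg measureReal_nonneg, inv_mul_eq_div, le_div_iff₀' hε]
  exact h x

section KernelMeasure

variable (κ : Kernel X Y) [∀ x, IsFiniteMeasure (κ x)] {μ : SignedMeasure X}

theorem integrable_measureReal_kernel (h : μ.Integrable fun x => (κ x).real univ)
    {A : Set Y} (hA : MeasurableSet A) : μ.Integrable fun x => (κ x).real A := by
  refine Integrable.mono' h (measurable_measureReal_kernel κ hA).aestronglyMeasurable
    (Eventually.of_forall fun x => ?_)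
  rw [Real.norm_of_nonneg measureReal_nonneg]
  exact measureReal_mono (subset_univ A)

open Classical in
/-- The image `A ↦ ∫ κ(x, A) μ(dx)` of a signed measure `μ` under a kernel `κ` whose mass is
`μ`-integrable. -/
def kernelMeasure (μ : SignedMeasure X) (h : μ.Integrable fun x => (κ x).real univ) :
    SignedMeasure Y where
  measureOf' A := if MeasurableSet A then ∫ᵛ x, (κ x).real A ∂•μ else 0
  empty' := by simp
  not_measurable' A hA := by simp [hA]
  m_iUnion' f hf hd := by
    simp only [hf, if_true, MeasurableSet.iUnion hf]
    have hsum (x : X) : HasSum (fun n => (κ x).real (f n)) ((κ x).real (⋃ n, f n)) :=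
      hasSum_measureReal (κ x) hf hd
    refine VectorMeasure.hasSum_integral_of_dominated_convergence (fun n x => (κ x).real (f n))
      (fun n => (measurable_measureReal_kernel κ (hf n)).aestronglyMeasurable)
      (fun n => Eventually.of_forall fun x => (Real.norm_of_nonneg measureReal_nonneg).le)
      (Eventually.of_forall fun x => (hsum x).summable) ?_ (Eventually.of_forall hsum)
    simp only [(hsum _).tsum_eq]
    exact integrable_measureReal_kernel κ h (MeasurableSet.iUnion hf)

theorem kernelMeasure_apply (h : μ.Integrable fun x => (κ x).real univ) {A : Set Y}
    (hA : MeasurableSet A) : kernelMeasure κ μ h A = ∫ᵛ x, (κ x).real A ∂•μ :=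
  if_pos hA

theorem variation_kernelMeasure_le (h : μ.Integrable fun x => (κ x).real univ) :
    (kernelMeasure κ μ h).variation ≤ μ.variation.bind κ := by
  refine VectorMeasure.variation_le_of_forall_enorm_le fun A hA => ?_
  rw [kernelMeasure_apply _ _ hA, Measure.bind_apply hA κ.aemeasurable]
  refine VectorMeasure.enorm_integral_le_lintegral_enorm_transpose.trans ?_
  rw [VectorMeasure.variation_transpose_lsmul]
  refine lintegral_mono fun x => ?_
  rw [Real.enorm_of_nonneg measureReal_nonneg, ofReal_measureReal]

end KernelMeasure

section KernelCLM

variable (κ : Kernel X Y) [IsFiniteKernel κ]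

theorem measureReal_kernel_le_bound (x : X) (A : Set Y) : (κ x).real A ≤ κ.bound.toReal :=
  ENNReal.toReal_mono κ.bound_ne_top (κ.measure_le_bound x A)

theorem integrable_measureReal_of_isFiniteKernel (μ : SignedMeasure X) :
    μ.Integrable fun x => (κ x).real univ := by
  refine Integrable.of_bound
    (measurable_measureReal_kernel κ MeasurableSet.univ).aestronglyMeasurable κ.bound.toReal
    (Eventually.of_forall fun x => ?_)
  rw [Real.norm_of_nonneg measureReal_nonneg]
  exact measureReal_kernel_le_bound κ x univ

theorem norm_kernelMeasure_le (μ : SignedMeasure X) :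
    ‖kernelMeasure κ μ (integrable_measureReal_of_isFiniteKernel κ μ)‖ ≤
      κ.bound.toReal * ‖μ‖ := by
  rw [norm_eq_variation, norm_eq_variation, measureReal_def, measureReal_def,
    ← ENNReal.toReal_mul]
  refine ENNReal.toReal_mono (ENNReal.mul_ne_top κ.bound_ne_top (measure_ne_top _ _))
    ((variation_kernelMeasure_le κ _ univ).trans ?_)
  rw [Measure.bind_apply MeasurableSet.univ κ.aemeasurable]
  exact (lintegral_mono fun x => κ.measure_le_bound x univ).trans_eq (lintegral_const _)

/-- The bounded operator `μ ↦ (A ↦ ∫ κ(x, A) μ(dx))` on signed measures given by a finite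
kernel `κ`. -/
def kernelCLM : SignedMeasure X →L[ℝ] SignedMeasure Y :=
  LinearMap.mkContinuous
    { toFun μ := kernelMeasure κ μ (integrable_measureReal_of_isFiniteKernel κ μ)
      map_add' μ ν := by
        ext A hA
        have hint (ρ : SignedMeasure X) :=
          integrable_measureReal_kernel κ (integrable_measureReal_of_isFiniteKernel κ ρ) hA
        simp only [add_apply, kernelMeasure_apply _ _ hA]
        exact VectorMeasure.integral_add_vectorMeasure (hint μ) (hint ν)
      map_smul' c μ := by
        ext A hA
        simp only [RingHom.id_apply, smul_apply, kernelMeasure_apply _ _ hA]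
        exact VectorMeasure.integral_smul_vectorMeasure _ c }
    κ.bound.toReal (norm_kernelMeasure_le κ)

theorem kernelCLM_apply (μ : SignedMeasure X) {A : Set Y} (hA : MeasurableSet A) :
    kernelCLM κ μ A = ∫ᵛ x, (κ x).real A ∂•μ :=
  kernelMeasure_apply κ (integrable_measureReal_of_isFiniteKernel κ μ) hA

theorem kernelCLM_nonneg {μ : SignedMeasure X} (h : 0 ≤ μ) : 0 ≤ kernelCLM κ μ :=
  nonneg_iff.2 fun A hA => by
    rw [kernelCLM_apply κ μ hA]
    exact integral_nonneg_of_nonneg h fun x => measureReal_nonneg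

end KernelCLM

section JumpProcess

/-- The kernel `κ(x, X) δₓ` describing the loss term of the jump process with jump kernel `κ`. -/
def lossKernel (κ : Kernel X Y) : Kernel X X where
  toFun x := κ x univ • Measure.dirac x
  measurable' := Measure.measurable_of_measurable_coe _ fun A hA => by
    simp only [Measure.smul_apply, smul_eq_mul, Measure.dirac_apply' _ hA]
    exact (κ.measurable_coe MeasurableSet.univ).mul (measurable_one.indicator hA)

theorem lossKernel_apply (κ : Kernel X Y) (x : X) :
    lossKernel κ x = κ x univ • Measure.dirac x := rfl

theorem measureReal_lossKernel (κ : Kernel X Y) (x : X) {A : Set X} (hA : MeasurableSet A) :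
    (lossKernel κ x).real A = (κ x).real univ * A.indicator (fun _ => (1 : ℝ)) x := by
  rw [lossKernel_apply, measureReal_ennreal_smul_apply, measureReal_def _ A,
    Measure.dirac_apply' _ hA]
  by_cases hx : x ∈ A <;> simp [hx, measureReal_def]

theorem measureReal_lossKernel_univ (κ : Kernel X Y) (x : X) :
    (lossKernel κ x).real univ = (κ x).real univ := by
  simp [measureReal_lossKernel κ x MeasurableSet.univ]

instance (κ : Kernel X Y) [∀ x, IsFiniteMeasure (κ x)] (x : X) :
    IsFiniteMeasure (lossKernel κ x) :=
  Measure.smul_finite _ (measure_ne_top _ _)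

instance (κ : Kernel X Y) [IsFiniteKernel κ] : IsFiniteKernel (lossKernel κ) :=
  ⟨κ.bound, κ.bound_lt_top, fun x => by
    simpa [lossKernel_apply] using κ.measure_le_bound x univ⟩

/-- The function `Q 1_A`, where `Q f x = ∫ (f y - f x) κ(x, dy)` is the generator of the jump
process with jump kernel `κ`. -/
def generatorIndicator (κ : Kernel X X) (A : Set X) (x : X) : ℝ :=
  (κ x).real A - (κ x).real univ * A.indicator (fun _ => (1 : ℝ)) x

/-- The graph of the forward generator of the jump process with jump kernel `κ`, on the signed
measures that integrate the jump rate `κ(x, X)`. -/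
def jumpGraph (κ : Kernel X X) : Set (SignedMeasure X × SignedMeasure X) :=
  {p | p.1.Integrable (fun x => (κ x).real univ) ∧
    ∀ A, MeasurableSet A → p.2 A = ∫ᵛ x, generatorIndicator κ A x ∂•p.1}

theorem apply_univ_of_mem_jumpGraph {κ : Kernel X X} {μ ν : SignedMeasure X}
    (h : (μ, ν) ∈ jumpGraph κ) : ν univ = 0 := by
  simp [h.2 univ MeasurableSet.univ, generatorIndicator]

theorem eq_of_mem_jumpGraph {κ : Kernel X X} {μ ν₁ ν₂ : SignedMeasure X}
    (h₁ : (μ, ν₁) ∈ jumpGraph κ) (h₂ : (μ, ν₂) ∈ jumpGraph κ) : ν₁ = ν₂ := by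
  ext A hA
  rw [h₁.2 A hA, h₂.2 A hA]

theorem kernelMeasure_sub_mem_jumpGraph (κ : Kernel X X) [∀ x, IsFiniteMeasure (κ x)]
    {μ : SignedMeasure X} (h : μ.Integrable fun x => (κ x).real univ)
    (h' : μ.Integrable fun x => (lossKernel κ x).real univ) :
    (μ, kernelMeasure κ μ h - kernelMeasure (lossKernel κ) μ h') ∈ jumpGraph κ := by
  refine ⟨h, fun A hA => ?_⟩
  simp only [sub_apply, kernelMeasure_apply _ _ hA]
  rw [← VectorMeasure.integral_sub (integrable_measureReal_kernel κ h hA)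
    (integrable_measureReal_kernel _ h' hA)]
  simp only [measureReal_lossKernel κ _ hA]
  rfl

theorem existsUnique_mem_jumpGraph (κ : Kernel X X) [∀ x, IsFiniteMeasure (κ x)]
    {μ : SignedMeasure X} (h : μ.Integrable fun x => (κ x).real univ) :
    ∃! ν, (μ, ν) ∈ jumpGraph κ :=
  ⟨_, kernelMeasure_sub_mem_jumpGraph κ h (by simpa only [measureReal_lossKernel_univ] using h),
    fun _ hν => eq_of_mem_jumpGraph hν (kernelMeasure_sub_mem_jumpGraph κ h _)⟩

/-- The forward generator of the jump process with finite jump kernel `κ`, as a bounded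
operator. -/
def jumpOp (κ : Kernel X X) [IsFiniteKernel κ] : SignedMeasure X →L[ℝ] SignedMeasure X :=
  kernelCLM κ - kernelCLM (lossKernel κ)

theorem mem_jumpGraph_jumpOp (κ : Kernel X X) [IsFiniteKernel κ] (μ : SignedMeasure X) :
    (μ, jumpOp κ μ) ∈ jumpGraph κ :=
  kernelMeasure_sub_mem_jumpGraph κ (integrable_measureReal_of_isFiniteKernel κ μ)
    (integrable_measureReal_of_isFiniteKernel (lossKernel κ) μ)

theorem kernelCLM_lossKernel_le (κ : Kernel X X) [IsFiniteKernel κ] {μ : SignedMeasure X}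
    (h : 0 ≤ μ) : kernelCLM (lossKernel κ) μ ≤ κ.bound.toReal • μ := by
  obtain ⟨m, _, rfl⟩ := exists_eq_toSignedMeasure h
  refine VectorMeasure.le_iff.2 fun A hA => ?_
  have hind : A.indicator (fun x => (κ x).real univ) =
      fun x => (κ x).real univ * A.indicator (fun _ => (1 : ℝ)) x := by
    ext x
    by_cases hx : x ∈ A <;> simp [hx]
  calc kernelCLM (lossKernel κ) m.toSignedMeasure A
      = ∫ x in A, (κ x).real univ ∂m := by
        simp only [kernelCLM_apply _ _ hA, measureReal_lossKernel κ _ hA]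
        rw [integral_toSignedMeasure_eq, ← integral_indicator hA, hind]
    _ ≤ ∫ _ in A, κ.bound.toReal ∂m := by
        refine integral_mono_of_nonneg (Eventually.of_forall fun _ => measureReal_nonneg)
          (integrable_const _) (Eventually.of_forall fun x => measureReal_kernel_le_bound κ x univ)
    _ = (κ.bound.toReal • m.toSignedMeasure) A := by
        rw [setIntegral_const, smul_apply, Measure.toSignedMeasure_apply_measurable hA,
          smul_eq_mul, smul_eq_mul, mul_comm]

theorem jumpOp_add_smul_nonneg (κ : Kernel X X) [IsFiniteKernel κ] {μ : SignedMeasure X}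
    (h : 0 ≤ μ) : 0 ≤ jumpOp κ μ + κ.bound.toReal • μ := by
  rw [jumpOp, sub_apply, sub_add_eq_add_sub, add_sub_assoc]
  exact add_nonneg (kernelCLM_nonneg κ h) (sub_nonneg.2 (kernelCLM_lossKernel_le κ h))

end JumpProcess

end Kernels

section Exponential

open NormedSpace

variable {V : Type*} [NormedAddCommGroup V] [NormedSpace ℝ V] (L : V →L[ℝ] V)

theorem exp_smul_apply_comm (t : ℝ) (v : V) : exp (t • L) (L v) = L (exp (t • L) v) :=
  congrArg (fun T : V →L[ℝ] V => T v) (((Commute.refl L).smul_left t).exp_left).eq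

variable [CompleteSpace V]

theorem exp_add_eq_mul_of_commute {A : Type*} [NormedRing A] [NormedAlgebra ℝ A]
    [CompleteSpace A] {x y : A} (h : Commute x y) : exp (x + y) = exp x * exp y :=
  exp_add_of_commute_of_mem_ball (𝕂 := ℝ) h ((expSeries_radius_eq_top ℝ A).symm ▸ edist_lt_top _ _)
    ((expSeries_radius_eq_top ℝ A).symm ▸ edist_lt_top _ _)

theorem exp_add_smul (s t : ℝ) : exp ((s + t) • L) = exp (s • L) * exp (t • L) := by
  rw [add_smul, exp_add_eq_mul_of_commute (((Commute.refl L).smul_left s).smul_right t)]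

theorem hasDerivAt_exp_smul_apply (v : V) (t : ℝ) :
    HasDerivAt (fun s : ℝ => exp (s • L) v) (exp (t • L) (L v)) t :=
  (hasDerivAt_exp_smul_const L t).clm_apply (hasDerivAt_const t v) |>.congr_deriv (by simp)

theorem continuous_exp_smul_apply (v : V) : Continuous fun s : ℝ => exp (s • L) v :=
  continuous_iff_continuousAt.2 fun t => (hasDerivAt_exp_smul_apply L v t).continuousAt

theorem integral_exp_smul_apply (v : V) (t : ℝ) :
    ∫ s in (0 : ℝ)..t, exp (s • L) (L v) = exp (t • L) v - v := by
  rw [intervalIntegral.integral_eq_sub_of_hasDerivAt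
    (fun s _ => hasDerivAt_exp_smul_apply L v s)
    ((continuous_exp_smul_apply L (L v)).intervalIntegrable _ _)]
  simp

variable {L}

theorem map_exp_smul_apply_eq {W : Type*} [NormedAddCommGroup W] [NormedSpace ℝ W]
    {f : V →L[ℝ] W} (hf : ∀ v, f (L v) = 0) (t : ℝ) (v : V) : f (exp (t • L) v) = f v := by
  have hderiv (s : ℝ) : HasDerivAt (fun s : ℝ => f (exp (s • L) v)) 0 s := by
    have := f.hasFDerivAt.comp_hasDerivAt s (hasDerivAt_exp_smul_apply L v s)
    rwa [exp_smul_apply_comm, hf] at this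
  simpa using is_const_of_deriv_eq_zero (fun s => (hderiv s).differentiableAt)
    (fun s => (hderiv s).deriv) t 0

theorem eq_exp_smul_apply_of_hasDerivAt {p : ℝ → V} (hp : ContinuousOn p (Ici 0))
    (hderiv : ∀ t, 0 < t → HasDerivAt p (L (p t)) t) {T : ℝ} (hT : 0 ≤ T) :
    p T = exp (T • L) (p 0) := by
  have hexp (s : ℝ) : HasDerivAt (fun r : ℝ => exp ((T - r) • L)) (-(exp ((T - s) • L) * L)) s :=
    (hasDerivAt_exp_smul_const L (T - s)).comp_const_sub T s
  have hcont : ContinuousOn (fun s => exp ((T - s) • L) (p s)) (Icc 0 T) :=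
    (continuous_iff_continuousAt.2 fun s => (hexp s).continuousAt).continuousOn.clm_apply
      (hp.mono Icc_subset_Ici_self)
  have hzero (s : ℝ) (hs : 0 < s) : HasDerivAt (fun s => exp ((T - s) • L) (p s)) 0 s :=
    ((hexp s).clm_apply (hderiv s hs)).congr_deriv (neg_add_cancel _)
  have hconst := intervalIntegral.integral_eq_sub_of_hasDerivAt_of_le hT hcont
    (fun s hs => hzero s hs.1) intervalIntegrable_const
  exact sub_eq_zero.1 (by simpa using hconst.symm)

section Positivity

variable [PartialOrder V] [IsOrderedAddMonoid V] [PosSMulMono ℝ V] [OrderClosedTopology V]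

theorem exp_apply_nonneg (hL : ∀ v, 0 ≤ v → 0 ≤ L v) {v : V} (hv : 0 ≤ v) : 0 ≤ exp L v := by
  have hpow (n : ℕ) : 0 ≤ (L ^ n) v := by
    induction n with
    | zero => exact hv
    | succ n ih => rw [pow_succ']; exact hL _ ih
  exact ((exp_series_hasSum_exp' (𝕂 := ℝ) L).mapL (ContinuousLinearMap.apply ℝ V v)).nonneg
    fun n => smul_nonneg (by positivity) (hpow n)

theorem exp_smul_apply_nonneg_of_add_smul_nonneg {C : ℝ} (hL : ∀ v, 0 ≤ v → 0 ≤ L v + C • v)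
    {t : ℝ} (ht : 0 ≤ t) {v : V} (hv : 0 ≤ v) : 0 ≤ exp (t • L) v := by
  have hsplit : t • L = algebraMap ℝ (V →L[ℝ] V) (-(t * C)) + t • (L + C • 1) := by
    rw [Algebra.algebraMap_eq_smul_one]
    module
  rw [hsplit, exp_add_eq_mul_of_commute (Algebra.commutes _ _), ← algebraMap_exp_comm,
    ← Real.exp_eq_exp_ℝ, Algebra.algebraMap_eq_smul_one, smul_mul_assoc, one_mul]
  exact smul_nonneg (Real.exp_pos _).le
    (exp_apply_nonneg (fun w hw => smul_nonneg ht (hL w hw)) hv)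

end Positivity

section JumpProcess

variable {X : Type*} [MeasurableSpace X] (κ : Kernel X X) [IsFiniteKernel κ]

theorem exp_jumpOp_nonneg {t : ℝ} (ht : 0 ≤ t) {μ : SignedMeasure X} (hμ : 0 ≤ μ) :
    0 ≤ exp (t • jumpOp κ) μ :=
  exp_smul_apply_nonneg_of_add_smul_nonneg (fun _ => jumpOp_add_smul_nonneg κ) ht hμ

theorem exp_jumpOp_apply_univ (t : ℝ) (μ : SignedMeasure X) :
    exp (t • jumpOp κ) μ univ = μ univ :=
  map_exp_smul_apply_eq (f := evalCLM univ)
    (fun ν => apply_univ_of_mem_jumpGraph (mem_jumpGraph_jumpOp κ ν)) t μ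

theorem norm_exp_jumpOp_le_one {t : ℝ} (ht : 0 ≤ t) : ‖exp (t • jumpOp κ)‖ ≤ 1 :=
  norm_le_one_of_nonneg_of_apply_univ (fun _ => exp_jumpOp_nonneg κ ht)
    (exp_jumpOp_apply_univ κ t)

end JumpProcess

end Exponential

/-- The projections `π i` decompose the space `V` into an `ℓ¹`-sum of subspaces, and the bounded
operators `L i` act in these subspaces and generate contractions. -/
structure IsGeneratorSum {ι V : Type*} [NormedAddCommGroup V] [NormedSpace ℝ V]
    (π L : ι → V →L[ℝ] V) : Prop where
  proj_of_ne : ∀ i j v, i ≠ j → π i (π j v) = 0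
  hasSum_proj : ∀ v, HasSum (fun i => π i v) v
  hasSum_norm : ∀ v, HasSum (fun i => ‖π i v‖) ‖v‖
  op_proj : ∀ i v, L i (π i v) = L i v
  proj_op : ∀ i v, π i (L i v) = L i v
  norm_exp_le : ∀ i (t : ℝ), 0 ≤ t → ‖NormedSpace.exp (t • L i)‖ ≤ 1

/-- The graph of the operator acting as `L i` on the range of `π i`, with maximal domain. -/
def sumGraph {ι V : Type*} [NormedAddCommGroup V] [NormedSpace ℝ V]
    (π L : ι → V →L[ℝ] V) : Set (V × V) :=
  {p | ∀ i, L i p.1 = π i p.2}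

theorem mem_sumGraph {ι V : Type*} [NormedAddCommGroup V] [NormedSpace ℝ V]
    {π L : ι → V →L[ℝ] V} {v w : V} : (v, w) ∈ sumGraph π L ↔ ∀ i, L i v = π i w :=
  Iff.rfl

theorem isClosed_sumGraph {ι V : Type*} [NormedAddCommGroup V] [NormedSpace ℝ V]
    (π L : ι → V →L[ℝ] V) : IsClosed (sumGraph π L) := by
  simp only [sumGraph, ofPred_forall]
  exact isClosed_iInter fun i => isClosed_eq (by fun_prop) (by fun_prop)

theorem tendsto_coe_nhdsGT_zero : Tendsto ((↑) : ℝ≥0 → ℝ) (𝓝[>] 0) (𝓝[>] 0) :=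
  tendsto_nhdsWithin_iff.2 ⟨(NNReal.continuous_coe.tendsto' 0 0 rfl).mono_left nhdsWithin_le_nhds,
    eventually_mem_nhdsWithin.mono fun _ ht => NNReal.coe_pos.2 ht⟩

namespace IsGeneratorSum

open NormedSpace

variable {ι V : Type*} [NormedAddCommGroup V] [NormedSpace ℝ V] {π L : ι → V →L[ℝ] V}

theorem proj_ext (h : IsGeneratorSum π L) {v w : V} (hvw : ∀ i, π i v = π i w) : v = w :=
  (h.hasSum_proj v).unique (by simpa only [hvw] using h.hasSum_proj w)

theorem proj_self (h : IsGeneratorSum π L) (i : ι) (v : V) : π i (π i v) = π i v :=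
  (hasSum_single i fun j hj => h.proj_of_ne i j v hj.symm).unique
    ((h.hasSum_proj v).mapL (π i))

theorem proj_exp (h : IsGeneratorSum π L) (i : ι) (t : ℝ) (v : V) :
    π i (exp (t • L i) v) = exp (t • L i) (π i v) := by
  have hcomm : Commute (π i) (L i) :=
    ContinuousLinearMap.ext fun v => (h.proj_op i v).trans (h.op_proj i v).symm
  exact congrArg (fun T : V →L[ℝ] V => T v) (hcomm.smul_right t).exp_right.eq

theorem norm_exp_proj_le (h : IsGeneratorSum π L) (t : ℝ≥0) (i : ι) (v : V) :
    ‖exp ((t : ℝ) • L i) (π i v)‖ ≤ ‖π i v‖ :=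
  (ContinuousLinearMap.le_opNorm _ _).trans
    (mul_le_of_le_one_left (norm_nonneg _) (h.norm_exp_le i t t.2))

theorem eq_of_mem_sumGraph (h : IsGeneratorSum π L) {v w w' : V} (hw : (v, w) ∈ sumGraph π L)
    (hw' : (v, w') ∈ sumGraph π L) : w = w' :=
  h.proj_ext fun i => (hw i).symm.trans (hw' i)

theorem finsetSum_proj_mem_sumGraph (h : IsGeneratorSum π L) {v w : V}
    (hw : (v, w) ∈ sumGraph π L) (s : Finset ι) :
    (∑ i ∈ s, π i v, ∑ i ∈ s, π i w) ∈ sumGraph π L := fun j => by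
  simp only [map_sum]
  refine Finset.sum_congr rfl fun i _ => ?_
  obtain rfl | hij := eq_or_ne j i
  · rw [h.op_proj, h.proj_self, mem_sumGraph.1 hw]
  · rw [← h.op_proj j (π i v), h.proj_of_ne j i v hij, map_zero, h.proj_of_ne j i w hij]

theorem closure_eq_sumGraph (h : IsGeneratorSum π L) {G : Set (V × V)} (hG : G ⊆ sumGraph π L)
    (hdom : ∀ (s : Finset ι) v, ∃ w, (∑ i ∈ s, π i v, w) ∈ G) : closure G = sumGraph π L := by
  refine (closure_minimal hG (isClosed_sumGraph π L)).antisymm ?_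
  rintro ⟨v, w⟩ hw
  refine mem_closure_of_tendsto (Tendsto.prodMk_nhds (h.hasSum_proj v) (h.hasSum_proj w))
    (Eventually.of_forall fun s => ?_)
  obtain ⟨w', hw'⟩ := hdom s v
  rwa [h.eq_of_mem_sumGraph (h.finsetSum_proj_mem_sumGraph hw s) (hG hw')]

variable [CompleteSpace V]

theorem summable_exp_proj (h : IsGeneratorSum π L) (t : ℝ≥0) (v : V) :
    Summable fun i => exp ((t : ℝ) • L i) (π i v) :=
  Summable.of_norm_bounded (h.hasSum_norm v).summable fun i => h.norm_exp_proj_le t i v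

/-- The semigroup acting as `exp (t L i)` on the range of `π i`. -/
def semigroup (h : IsGeneratorSum π L) (t : ℝ≥0) : V →L[ℝ] V :=
  LinearMap.mkContinuous
    { toFun := fun v => ∑' i, exp ((t : ℝ) • L i) (π i v)
      map_add' := fun v w => by
        simp only [map_add]
        exact (h.summable_exp_proj t v).tsum_add (h.summable_exp_proj t w)
      map_smul' := fun c v => by
        simp only [map_smul, RingHom.id_apply]
        exact (h.summable_exp_proj t v).tsum_const_smul c } 1
    (fun v => by
      rw [one_mul]
      exact tsum_of_norm_bounded (h.hasSum_norm v) fun i => h.norm_exp_proj_le t i v)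

theorem hasSum_semigroup (h : IsGeneratorSum π L) (t : ℝ≥0) (v : V) :
    HasSum (fun i => exp ((t : ℝ) • L i) (π i v)) (h.semigroup t v) :=
  (h.summable_exp_proj t v).hasSum

theorem proj_semigroup (h : IsGeneratorSum π L) (t : ℝ≥0) (i : ι) (v : V) :
    π i (h.semigroup t v) = exp ((t : ℝ) • L i) (π i v) := by
  have hsingle := hasSum_single (f := fun j => π i (exp ((t : ℝ) • L j) (π j v))) i fun j hj => by
    rw [← h.proj_exp, h.proj_of_ne i j _ hj.symm]
  rw [((h.hasSum_semigroup t v).mapL (π i)).unique hsingle, h.proj_exp, h.proj_self]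

theorem op_semigroup (h : IsGeneratorSum π L) (t : ℝ≥0) (i : ι) (v : V) :
    L i (h.semigroup t v) = exp ((t : ℝ) • L i) (L i v) := by
  rw [← h.op_proj, h.proj_semigroup, ← exp_smul_apply_comm, h.op_proj]

theorem continuous_semigroup (h : IsGeneratorSum π L) (v : V) :
    Continuous fun t : ℝ≥0 => h.semigroup t v :=
  continuous_iff_continuousAt.2 fun t =>
    tendsto_tsum_of_dominated_convergence (h.hasSum_norm v).summable
      (fun i => ((continuous_exp_smul_apply (L i) (π i v)).comp NNReal.continuous_coe).tendsto t)
      (Eventually.of_forall fun s i => h.norm_exp_proj_le s i v)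

theorem continuous_semigroup_toNNReal (h : IsGeneratorSum π L) (v : V) :
    Continuous fun t : ℝ => h.semigroup t.toNNReal v :=
  (h.continuous_semigroup v).comp continuous_real_toNNReal

theorem semigroup_zero (h : IsGeneratorSum π L) (v : V) : h.semigroup 0 v = v :=
  h.proj_ext fun i => by simp [h.proj_semigroup]

theorem isC0Semigroup (h : IsGeneratorSum π L) : IsC0Semigroup h.semigroup where
  map_zero := ContinuousLinearMap.ext h.semigroup_zero
  map_add s t := by
    refine ContinuousLinearMap.ext fun v => h.proj_ext fun i => ?_
    rw [ContinuousLinearMap.comp_apply, h.proj_semigroup, h.proj_semigroup, h.proj_semigroup,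
      NNReal.coe_add, exp_add_smul]
    rfl
  tendsto_zero v :=
    ((h.continuous_semigroup v).tendsto' 0 v (h.semigroup_zero v)).mono_left nhdsWithin_le_nhds

theorem semigroup_mem_sumGraph (h : IsGeneratorSum π L) {v w : V} (hw : (v, w) ∈ sumGraph π L)
    (t : ℝ≥0) : (h.semigroup t v, h.semigroup t w) ∈ sumGraph π L := fun i => by
  rw [h.op_semigroup, h.proj_semigroup, mem_sumGraph.1 hw]

theorem integral_semigroup_mem_sumGraph (h : IsGeneratorSum π L) (v : V) {t : ℝ} (ht : 0 ≤ t) :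
    (∫ s in (0 : ℝ)..t, h.semigroup s.toNNReal v, h.semigroup t.toNNReal v - v)
      ∈ sumGraph π L := fun i => by
  rw [← ContinuousLinearMap.intervalIntegral_comp_comm _
    ((h.continuous_semigroup_toNNReal v).intervalIntegrable _ _), map_sub, h.proj_semigroup,
    Real.coe_toNNReal t ht, ← integral_exp_smul_apply, h.op_proj]
  refine intervalIntegral.integral_congr fun s hs => ?_
  rw [uIcc_of_le ht] at hs
  rw [h.op_semigroup, Real.coe_toNNReal s hs.1]

theorem semigroup_sub_eq_integral (h : IsGeneratorSum π L) {v w : V}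
    (hw : (v, w) ∈ sumGraph π L) {t : ℝ} (ht : 0 ≤ t) :
    h.semigroup t.toNNReal v - v = ∫ s in (0 : ℝ)..t, h.semigroup s.toNNReal w := by
  refine h.proj_ext fun i => ?_
  rw [← h.integral_semigroup_mem_sumGraph v ht i,
    ← ContinuousLinearMap.intervalIntegral_comp_comm _
    ((h.continuous_semigroup_toNNReal w).intervalIntegrable _ _),
    ← ContinuousLinearMap.intervalIntegral_comp_comm _
    ((h.continuous_semigroup_toNNReal v).intervalIntegrable _ _)]
  exact intervalIntegral.integral_congr fun s _ => h.semigroup_mem_sumGraph hw s.toNNReal i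

theorem hasDerivAt_semigroup (h : IsGeneratorSum π L) {v w : V} (hw : (v, w) ∈ sumGraph π L)
    {t : ℝ} (ht : 0 < t) :
    HasDerivAt (fun t => h.semigroup t.toNNReal v) (h.semigroup t.toNNReal w) t := by
  have hint := ((h.continuous_semigroup_toNNReal w).integral_hasStrictDerivAt 0 t).hasDerivAt
  refine (hint.const_add v).congr_of_eventuallyEq ?_
  filter_upwards [lt_mem_nhds ht] with s hs
  rw [← h.semigroup_sub_eq_integral hw hs.le, add_sub_cancel]

theorem isMildSolution (h : IsGeneratorSum π L) (v : V) :
    IsMildSolution (sumGraph π L) v fun t => h.semigroup t.toNNReal v where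
  continuousOn := (h.continuous_semigroup_toNNReal v).continuousOn
  equation _ ht := h.integral_semigroup_mem_sumGraph v ht

theorem isClassicalSolution (h : IsGeneratorSum π L) {v w : V} (hw : (v, w) ∈ sumGraph π L) :
    IsClassicalSolution (sumGraph π L) v fun t => h.semigroup t.toNNReal v where
  initial := by simp only [Real.toNNReal_zero, h.semigroup_zero]
  continuousOn := (h.continuous_semigroup_toNNReal v).continuousOn
  differentiableAt _ ht := (h.hasDerivAt_semigroup hw ht).differentiableAt
  continuousOn_deriv := (h.continuous_semigroup_toNNReal w).continuousOn.congr fun _ ht =>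
    (h.hasDerivAt_semigroup hw ht).deriv
  mem_domain t _ := ⟨_, h.semigroup_mem_sumGraph hw t.toNNReal⟩
  equation t ht :=
    (h.hasDerivAt_semigroup hw ht).deriv ▸ h.semigroup_mem_sumGraph hw t.toNNReal

theorem isClassicalSolution_of_subset (h : IsGeneratorSum π L) {G : Set (V × V)}
    (hG : G ⊆ sumGraph π L) {v : V} (hdom : ∀ t, ∃ w, (h.semigroup t v, w) ∈ G) :
    IsClassicalSolution G v fun t => h.semigroup t.toNNReal v := by
  obtain ⟨w, hw⟩ := hdom 0
  rw [h.semigroup_zero] at hw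
  have hu := h.isClassicalSolution (hG hw)
  refine { hu with mem_domain := fun t _ => hdom t.toNNReal, equation := fun t ht => ?_ }
  obtain ⟨w', hw'⟩ := hdom t.toNNReal
  rwa [h.eq_of_mem_sumGraph (hu.equation t ht) (hG hw')]

theorem eq_semigroup_of_hasDerivAt (h : IsGeneratorSum π L) {u : ℝ → V}
    (hu : ContinuousOn u (Ici 0))
    (hderiv : ∀ i t, 0 < t → HasDerivAt (fun s => π i (u s)) (L i (u t)) t) (t : ℝ≥0) :
    u t = h.semigroup t (u 0) := by
  refine h.proj_ext fun i => ?_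
  rw [h.proj_semigroup]
  refine eq_exp_smul_apply_of_hasDerivAt ((π i).continuous.comp_continuousOn hu)
    (fun s hs => ?_) t.2
  rw [Function.comp_apply, h.op_proj]
  exact hderiv i s hs

theorem eq_semigroup_of_isMildSolution (h : IsGeneratorSum π L) {v : V} {u : ℝ → V}
    (hu : IsMildSolution (sumGraph π L) v u) (t : ℝ≥0) : u t = h.semigroup t v := by
  have hproj (i : ι) (s : ℝ) (hs : 0 ≤ s) : π i (u s) = π i v + L i (∫ r in (0 : ℝ)..s, u r) := by
    rw [mem_sumGraph.1 (hu.equation s hs), map_sub, add_sub_cancel]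
  have hinit : u 0 = v := h.proj_ext fun i => by simpa using hproj i 0 le_rfl
  have hinterior : ContinuousOn u (Ioi 0) := hu.continuousOn.mono Ioi_subset_Ici_self
  have hderiv (s : ℝ) (hs : 0 < s) : HasDerivAt (fun s => ∫ r in (0 : ℝ)..s, u r) (u s) s :=
    intervalIntegral.integral_hasDerivAt_right
      (hu.continuousOn.mono
        (by simpa [uIcc_of_le hs.le] using Icc_subset_Ici_self)).intervalIntegrable
      (hinterior.stronglyMeasurableAtFilter isOpen_Ioi s hs)
      (hinterior.continuousAt (Ioi_mem_nhds hs))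
  rw [← hinit]
  refine h.eq_semigroup_of_hasDerivAt hu.continuousOn (fun i s hs => ?_) t
  refine (((L i).hasFDerivAt.comp_hasDerivAt s (hderiv s hs)).const_add
    (π i v)).congr_of_eventuallyEq ?_
  filter_upwards [lt_mem_nhds hs] with r hr using hproj i r hr.le

theorem eq_semigroup_of_isClassicalSolution (h : IsGeneratorSum π L) {v : V} {u : ℝ → V}
    (hu : IsClassicalSolution (sumGraph π L) v u) (t : ℝ≥0) : u t = h.semigroup t v := by
  rw [← hu.initial]
  refine h.eq_semigroup_of_hasDerivAt hu.continuousOn (fun i s hs => ?_) t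
  rw [mem_sumGraph.1 (hu.equation s hs)]
  exact (π i).hasFDerivAt.comp_hasDerivAt s (hu.differentiableAt s hs).hasDerivAt

theorem generatorGraph_semigroup (h : IsGeneratorSum π L) :
    generatorGraph h.semigroup = sumGraph π L := by
  ext ⟨v, w⟩
  constructor
  · intro hw i
    have hquot := ((π i).continuous.tendsto w).comp hw
    have hexp := (hasDerivAt_exp_smul_apply (L i) (π i v) 0).tendsto_slope_zero_right.comp
      tendsto_coe_nhdsGT_zero
    simpa [h.op_proj] using
      tendsto_nhds_unique hexp (hquot.congr fun t => by simp [h.proj_semigroup])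
  · intro hw
    have hint := ((h.continuous_semigroup_toNNReal w).integral_hasStrictDerivAt 0
      0).hasDerivAt.tendsto_slope_zero_right.comp tendsto_coe_nhdsGT_zero
    have hquot : Tendsto (fun t : ℝ≥0 => (t : ℝ)⁻¹ • (h.semigroup t v - v)) (𝓝[>] 0)
        (𝓝 (h.semigroup (0 : ℝ).toNNReal w)) := hint.congr fun t => by
      have := h.semigroup_sub_eq_integral hw t.coe_nonneg
      rw [Real.toNNReal_coe] at this
      simp [this]
    simpa [h.semigroup_zero, generatorGraph] using hquot

end IsGeneratorSum

/-- The jump process with jump kernel `κ` conserves the charge `N`, and its jump rates are bounded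
on each set of constant charge. -/
structure IsConservative {X ι : Type*} [MeasurableSpace X] [MeasurableSpace ι] (κ : Kernel X X)
    (N : X → ι) : Prop where
  measurable_charge : Measurable N
  exists_mass_le : ∀ i, ∃ C : ℝ≥0, ∀ x, N x = i → κ x univ ≤ C
  ae_charge_eq : ∀ x, ∀ᵐ y ∂κ x, N y = N x

section Fibers

variable {X ι : Type*} {N : X → ι}

theorem pairwise_disjoint_fiber (N : X → ι) :
    Pairwise (Function.onFun Disjoint fun i => N ⁻¹' {i}) := fun _ _ hij =>
  Disjoint.preimage N (disjoint_singleton.2 hij)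

theorem iUnion_fiber (N : X → ι) : ⋃ i, N ⁻¹' {i} = univ :=
  eq_univ_of_forall fun x => mem_iUnion.2 ⟨N x, rfl⟩

variable [MeasurableSpace X] [MeasurableSpace ι] [MeasurableSingletonClass ι] [Countable ι]

theorem map_eq_map_of_apply_fiber_eq (hN : Measurable N) {m m' : Measure X}
    [IsFiniteMeasure m] [IsFiniteMeasure m']
    (h : ∀ i, m.real (N ⁻¹' {i}) = m'.real (N ⁻¹' {i})) : m.map N = m'.map N :=
  Measure.ext_of_singleton fun i => by
    rw [Measure.map_apply hN (measurableSet_singleton i),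
      Measure.map_apply hN (measurableSet_singleton i)]
    exact (measureReal_eq_measureReal_iff).1 (h i)

theorem integrable_comp_of_apply_fiber_eq (hN : Measurable N)
    {μ ν : SignedMeasure X} (hμ : 0 ≤ μ) (hν : 0 ≤ ν) (h : ∀ i, μ (N ⁻¹' {i}) = ν (N ⁻¹' {i}))
    {g : ι → ℝ} (hg : μ.Integrable (g ∘ N)) : ν.Integrable (g ∘ N) := by
  obtain ⟨m, _, rfl⟩ := exists_eq_toSignedMeasure hμ
  obtain ⟨m', _, rfl⟩ := exists_eq_toSignedMeasure hν
  simp only [Measure.toSignedMeasure_apply_measurable (hN (measurableSet_singleton _))] at h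
  unfold VectorMeasure.Integrable at hg ⊢
  rw [Measure.variation_toSignedMeasure] at hg ⊢
  have hgm (ρ : Measure ι) : AEStronglyMeasurable g ρ :=
    (measurable_of_countable g).aestronglyMeasurable
  rw [← integrable_map_measure (hgm _) hN.aemeasurable] at hg ⊢
  rwa [← map_eq_map_of_apply_fiber_eq hN h]

end Fibers

namespace IsConservative

variable {X ι : Type*} [MeasurableSpace X] [MeasurableSpace ι] {κ : Kernel X X} {N : X → ι}

theorem isFiniteMeasure (h : IsConservative κ N) (x : X) : IsFiniteMeasure (κ x) :=
  let ⟨_, hC⟩ := h.exists_mass_le (N x)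
  ⟨(hC x rfl).trans_lt ENNReal.coe_lt_top⟩

theorem existsUnique_mem_jumpGraph (h : IsConservative κ N) {μ : SignedMeasure X}
    (hμ : μ.Integrable fun x => (κ x).real univ) : ∃! ν, (μ, ν) ∈ jumpGraph κ :=
  have := h.isFiniteMeasure
  Kawasaki.existsUnique_mem_jumpGraph κ hμ

theorem measureReal_inter_fiber (h : IsConservative κ N) (A : Set X) (i : ι) (x : X) :
    (κ x).real (A ∩ N ⁻¹' {i}) = (N ⁻¹' {i}).indicator (fun x => (κ x).real A) x := by
  by_cases hx : x ∈ N ⁻¹' {i}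
  · rw [indicator_of_mem hx]
    refine measureReal_congr (inter_ae_eq_left_of_ae_eq_univ ?_)
    filter_upwards [h.ae_charge_eq x] with y hy
    exact eq_true (hy.trans hx)
  · have hnull : κ x (A ∩ N ⁻¹' {i}) = 0 :=
      measure_mono_null (fun y hy (hyx : N y = N x) => hx (hyx.symm.trans hy.2))
        (ae_iff.1 (h.ae_charge_eq x))
    rw [indicator_of_notMem hx, measureReal_def, hnull, ENNReal.toReal_zero]

theorem generatorIndicator_inter_fiber (h : IsConservative κ N) (A : Set X) (i : ι) :
    generatorIndicator κ (A ∩ N ⁻¹' {i}) = (N ⁻¹' {i}).indicator (generatorIndicator κ A) := by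
  ext x
  rw [generatorIndicator, h.measureReal_inter_fiber, inter_comm, ← indicator_indicator]
  by_cases hx : x ∈ N ⁻¹' {i} <;> simp [hx, generatorIndicator]

variable [MeasurableSingletonClass ι]

theorem measurableSet_fiber (h : IsConservative κ N) (i : ι) : MeasurableSet (N ⁻¹' {i}) :=
  h.measurable_charge (measurableSet_singleton i)

open Classical in
/-- The part of the jump kernel acting on the points of charge `i`. -/
def fiberKernel (h : IsConservative κ N) (i : ι) : Kernel X X :=
  Kernel.piecewise (h.measurableSet_fiber i) κ 0

instance (h : IsConservative κ N) (i : ι) : IsFiniteKernel (h.fiberKernel i) := by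
  classical
  obtain ⟨C, hC⟩ := h.exists_mass_le i
  refine ⟨C, ENNReal.coe_lt_top, fun x => ?_⟩
  rw [fiberKernel, Kernel.piecewise_apply']
  split_ifs with hx
  exacts [hC x hx, zero_le]

theorem generatorIndicator_fiberKernel (h : IsConservative κ N) (i : ι) (A : Set X) :
    generatorIndicator (h.fiberKernel i) A =
      (N ⁻¹' {i}).indicator (generatorIndicator κ A) := by
  classical
  ext x
  rw [generatorIndicator, fiberKernel, Kernel.piecewise_apply]
  by_cases hx : x ∈ N ⁻¹' {i} <;> simp [hx, generatorIndicator]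

theorem jumpOp_fiberKernel_apply (h : IsConservative κ N) (i : ι) (μ : SignedMeasure X)
    {A : Set X} (hA : MeasurableSet A) :
    jumpOp (h.fiberKernel i) μ A =
      ∫ᵛ x, (N ⁻¹' {i}).indicator (generatorIndicator κ A) x ∂•μ := by
  rw [(mem_jumpGraph_jumpOp (h.fiberKernel i) μ).2 A hA, generatorIndicator_fiberKernel]

theorem integrable_measureReal_restrict_fiber (h : IsConservative κ N) (i : ι)
    (μ : SignedMeasure X) : (μ.restrict (N ⁻¹' {i})).Integrable fun x => (κ x).real univ := by
  obtain ⟨C, hC⟩ := h.exists_mass_le i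
  unfold VectorMeasure.Integrable
  rw [VectorMeasure.variation_restrict (h.measurableSet_fiber i)]
  refine Integrable.of_bound
    (measurable_measureReal_kernel κ MeasurableSet.univ).aestronglyMeasurable C ?_
  filter_upwards [ae_restrict_mem (h.measurableSet_fiber i)] with x hx
  rw [Real.norm_of_nonneg measureReal_nonneg]
  exact ENNReal.toReal_mono ENNReal.coe_ne_top (hC x hx)

theorem jumpGraph_subset_sumGraph (h : IsConservative κ N) :
    jumpGraph κ ⊆
      sumGraph (fun i => restrictCLM (N ⁻¹' {i})) fun i => jumpOp (h.fiberKernel i) := by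
  rintro ⟨μ, ν⟩ hν
  refine mem_sumGraph.2 fun i => VectorMeasure.ext fun A hA => ?_
  rw [restrictCLM_apply, VectorMeasure.restrict_apply _ (h.measurableSet_fiber i) hA,
    h.jumpOp_fiberKernel_apply i _ hA, hν.2 _ (hA.inter (h.measurableSet_fiber i)),
    h.generatorIndicator_inter_fiber]

variable [Countable ι]

theorem isGeneratorSum (h : IsConservative κ N) :
    IsGeneratorSum (fun i => restrictCLM (N ⁻¹' {i})) fun i => jumpOp (h.fiberKernel i) where
  proj_of_ne i j μ hij := by
    rw [restrictCLM_apply, restrictCLM_apply,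
      VectorMeasure.restrict_restrict _ (h.measurableSet_fiber i) (h.measurableSet_fiber j),
      (pairwise_disjoint_fiber N hij).inter_eq, VectorMeasure.restrict_empty]
  hasSum_proj := hasSum_restrict h.measurableSet_fiber (pairwise_disjoint_fiber N) (iUnion_fiber N)
  hasSum_norm :=
    hasSum_norm_restrict h.measurableSet_fiber (pairwise_disjoint_fiber N) (iUnion_fiber N)
  op_proj i μ := by
    ext A hA
    rw [h.jumpOp_fiberKernel_apply i _ hA, h.jumpOp_fiberKernel_apply i _ hA, restrictCLM_apply,
      ← VectorMeasure.integral_indicator (h.measurableSet_fiber i), indicator_indicator,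
      inter_self]
  proj_op i μ := by
    ext A hA
    rw [restrictCLM_apply, VectorMeasure.restrict_apply _ (h.measurableSet_fiber i) hA,
      h.jumpOp_fiberKernel_apply i _ hA,
      h.jumpOp_fiberKernel_apply i _ (hA.inter (h.measurableSet_fiber i)),
      h.generatorIndicator_inter_fiber, indicator_indicator, inter_self]
  norm_exp_le i _ ht := norm_exp_jumpOp_le_one (h.fiberKernel i) ht

theorem closure_jumpGraph (h : IsConservative κ N) :
    closure (jumpGraph κ) =
      sumGraph (fun i => restrictCLM (N ⁻¹' {i})) fun i => jumpOp (h.fiberKernel i) :=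
  h.isGeneratorSum.closure_eq_sumGraph h.jumpGraph_subset_sumGraph fun _ μ =>
    (h.existsUnique_mem_jumpGraph (VectorMeasure.Integrable.finsetSum_vectorMeasure
      fun i _ => h.integrable_measureReal_restrict_fiber i μ)).exists

/-- The semigroup generated by the closure of the forward generator of the jump process. -/
def semigroup (h : IsConservative κ N) : ℝ≥0 → SignedMeasure X →L[ℝ] SignedMeasure X :=
  h.isGeneratorSum.semigroup

theorem generatorGraph_semigroup (h : IsConservative κ N) :
    generatorGraph h.semigroup = closure (jumpGraph κ) :=
  h.isGeneratorSum.generatorGraph_semigroup.trans h.closure_jumpGraph.symm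

theorem semigroup_nonneg (h : IsConservative κ N) (t : ℝ≥0) {μ : SignedMeasure X} (hμ : 0 ≤ μ) :
    0 ≤ h.semigroup t μ :=
  (h.isGeneratorSum.hasSum_semigroup t μ).nonneg fun i =>
    exp_jumpOp_nonneg (h.fiberKernel i) t.2 <| nonneg_iff.2 fun A hA => by
      rw [restrictCLM_apply, VectorMeasure.restrict_apply _ (h.measurableSet_fiber i) hA]
      exact nonneg_iff.1 hμ _ (hA.inter (h.measurableSet_fiber i))

theorem semigroup_apply_fiber (h : IsConservative κ N) (t : ℝ≥0) (μ : SignedMeasure X) (i : ι) :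
    h.semigroup t μ (N ⁻¹' {i}) = μ (N ⁻¹' {i}) := by
  rw [← VectorMeasure.restrict_apply_univ, ← VectorMeasure.restrict_apply_univ (v := μ),
    ← restrictCLM_apply, ← restrictCLM_apply, semigroup, h.isGeneratorSum.proj_semigroup]
  exact exp_jumpOp_apply_univ (h.fiberKernel i) t _

theorem semigroup_apply_univ (h : IsConservative κ N) (t : ℝ≥0) (μ : SignedMeasure X) :
    h.semigroup t μ univ = μ univ := by
  have hsum (ν : SignedMeasure X) : HasSum (fun i => ν (N ⁻¹' {i})) (ν univ) := by
    rw [← iUnion_fiber N]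
    exact VectorMeasure.hasSum_of_disjoint_iUnion h.measurableSet_fiber (pairwise_disjoint_fiber N)
  exact (hsum _).unique (by simpa only [h.semigroup_apply_fiber] using hsum μ)

theorem isStochasticSemigroup (h : IsConservative κ N) : IsStochasticSemigroup h.semigroup where
  toIsC0Semigroup := h.isGeneratorSum.isC0Semigroup
  nonneg t _ hμ := h.semigroup_nonneg t hμ
  norm_eq_one t μ hμ hnorm := by
    rw [norm_eq_apply_univ_of_nonneg (h.semigroup_nonneg t hμ), h.semigroup_apply_univ,
      ← norm_eq_apply_univ_of_nonneg hμ, hnorm]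

theorem isMildSolution (h : IsConservative κ N) (μ : SignedMeasure X) :
    IsMildSolution (closure (jumpGraph κ)) μ fun t => h.semigroup t.toNNReal μ :=
  h.closure_jumpGraph ▸ h.isGeneratorSum.isMildSolution μ

theorem eq_semigroup_of_isMildSolution (h : IsConservative κ N) {μ : SignedMeasure X}
    {u : ℝ → SignedMeasure X} (hu : IsMildSolution (closure (jumpGraph κ)) μ u) (t : ℝ≥0) :
    u t = h.semigroup t μ :=
  h.isGeneratorSum.eq_semigroup_of_isMildSolution (h.closure_jumpGraph ▸ hu) t

theorem isClassicalSolution_closure (h : IsConservative κ N) {μ ν : SignedMeasure X}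
    (hν : (μ, ν) ∈ closure (jumpGraph κ)) :
    IsClassicalSolution (closure (jumpGraph κ)) μ fun t => h.semigroup t.toNNReal μ := by
  rw [h.closure_jumpGraph] at hν ⊢
  exact h.isGeneratorSum.isClassicalSolution hν

theorem eq_semigroup_of_isClassicalSolution (h : IsConservative κ N) {μ : SignedMeasure X}
    {u : ℝ → SignedMeasure X} (hu : IsClassicalSolution (closure (jumpGraph κ)) μ u) (t : ℝ≥0) :
    u t = h.semigroup t μ :=
  h.isGeneratorSum.eq_semigroup_of_isClassicalSolution (h.closure_jumpGraph ▸ hu) t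

theorem integrable_comp_charge_semigroup (h : IsConservative κ N) (t : ℝ≥0)
    {μ : SignedMeasure X} (hμ : 0 ≤ μ) {g : ι → ℝ} (hg : μ.Integrable (g ∘ N)) :
    (h.semigroup t μ).Integrable (g ∘ N) :=
  integrable_comp_of_apply_fiber_eq h.measurable_charge hμ (h.semigroup_nonneg t hμ)
    (fun i => (h.semigroup_apply_fiber t μ i).symm) hg

theorem isClassicalSolution (h : IsConservative κ N) {μ : SignedMeasure X} (hμ : 0 ≤ μ)
    {g : ι → ℝ} (hg : μ.Integrable (g ∘ N)) {ε : ℝ} (hε : 0 < ε)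
    (hbound : ∀ x, ε * (κ x).real univ ≤ g (N x)) :
    IsClassicalSolution (jumpGraph κ) μ fun t => h.semigroup t.toNNReal μ :=
  h.isGeneratorSum.isClassicalSolution_of_subset h.jumpGraph_subset_sumGraph fun t =>
    (h.existsUnique_mem_jumpGraph (integrable_measureReal_kernel_of_mul_le κ
      (h.integrable_comp_charge_semigroup t hμ hg) hε hbound)).exists

end IsConservative

section Configurations

variable {d : ℕ}

/-- The `n`-tuples of distinct points, which `ofTuple n` maps onto the `n`-point configurations. -/
abbrev InjTuple (d n : ℕ) : Type :=
  {x : Fin n → EuclideanSpace ℝ (Fin d) // Function.Injective x}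

/-- The configuration of a tuple of distinct points of any length, as one quotient map from the
disjoint union of the spaces of tuples. -/
def ofSigma (x : Σ n, InjTuple d n) : FinConf d := ofTuple x.1 x.2

/-- The configurations with a point in `U`. -/
def hitting (U : Set (EuclideanSpace ℝ (Fin d))) : Set (FinConf d) := {η | ∃ p ∈ η.pts, p ∈ U}

theorem sum_pts_ofTuple {M : Type*} [AddCommMonoid M] {n : ℕ} (x : InjTuple d n)
    (f : EuclideanSpace ℝ (Fin d) → M) : ∑ p ∈ (ofTuple n x).pts, f p = ∑ i, f (x.1 i) :=
  Finset.sum_map _ _ _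

theorem card_pts_ofTuple {n : ℕ} (x : InjTuple d n) : (ofTuple n x).pts.card = n := by
  simp [ofTuple]

theorem ofTuple_mem_hitting {n : ℕ} {x : InjTuple d n} {U : Set (EuclideanSpace ℝ (Fin d))} :
    ofTuple n x ∈ hitting U ↔ ∃ i, x.1 i ∈ U := by
  simp [ofTuple, hitting]

theorem surjective_ofSigma : Function.Surjective (ofSigma (d := d)) := by
  refine fun η => ⟨⟨_, fun i => η.pts.equivFin.symm i,
    Subtype.val_injective.comp η.pts.equivFin.symm.injective⟩, FinConf.ext (Finset.ext fun p => ?_)⟩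
  simp only [ofSigma, ofTuple, Finset.mem_map, Finset.mem_univ, true_and]
  exact ⟨fun ⟨i, hi⟩ => hi ▸ (η.pts.equivFin.symm i).2,
    fun hp => ⟨η.pts.equivFin ⟨p, hp⟩, by simp⟩⟩

theorem isOpen_injective {n : ℕ} {Y : Type*} [TopologicalSpace Y] [T2Space Y] :
    IsOpen {x : Fin n → Y | Function.Injective x} := by
  simp only [Function.injective_iff_pairwise_ne, Pairwise, Set.ofPred_forall]
  exact isOpen_iInter_of_finite fun i => isOpen_iInter_of_finite fun j =>
    isOpen_iInter_of_finite fun _ => isOpen_ne_fun (continuous_apply i) (continuous_apply j)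

instance polishSpace_injTuple (n : ℕ) : PolishSpace (InjTuple d n) :=
  isOpen_injective.polishSpace

theorem measurableSet_sigma_iff {ι : Type*} {Y : ι → Type*} [∀ i, MeasurableSpace (Y i)]
    {A : Set (Σ i, Y i)} : MeasurableSet A ↔ ∀ i, MeasurableSet (Sigma.mk i ⁻¹' A) :=
  MeasurableSpace.measurableSet_iInf

instance borelSpace_sigma {ι : Type*} [Countable ι] {Y : ι → Type*} [∀ i, TopologicalSpace (Y i)]
    [∀ i, MeasurableSpace (Y i)] [∀ i, BorelSpace (Y i)] : BorelSpace (Σ i, Y i) := by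
  refine ⟨le_antisymm (fun A hA => ?_) (MeasurableSpace.generateFrom_le fun U hU => ?_)⟩
  · borelize (Σ i, Y i)
    rw [← iUnion_image_preimage_sigma_mk_eq_self (s := A)]
    exact MeasurableSet.iUnion fun i =>
      IsOpenEmbedding.sigmaMk.measurableEmbedding.measurableSet_image.2
        (measurableSet_sigma_iff.1 hA i)
  · exact measurableSet_sigma_iff.2 fun i => (isOpen_sigma_iff.1 hU i).measurableSet

theorem isOpen_finConf_iff {U : Set (FinConf d)} : IsOpen U ↔ ∀ n, IsOpen (ofTuple n ⁻¹' U) :=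
  isOpen_iSup_iff

theorem continuous_ofTuple (n : ℕ) : Continuous (ofTuple (d := d) n) :=
  ⟨fun _ hU => isOpen_finConf_iff.1 hU n⟩

theorem measurable_ofSigma : Measurable (ofSigma (d := d)) :=
  (continuous_sigma continuous_ofTuple).measurable

theorem isOpen_hitting {U : Set (EuclideanSpace ℝ (Fin d))} (hU : IsOpen U) :
    IsOpen (hitting U) := by
  refine isOpen_finConf_iff.2 fun n => ?_
  simp only [preimage, ofTuple_mem_hitting, ofPred_exists]
  exact isOpen_iUnion fun i => hU.preimage ((continuous_apply i).comp continuous_subtype_val)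

theorem eq_of_forall_mem_hitting_iff {B : Set (Set (EuclideanSpace ℝ (Fin d)))}
    (hB : TopologicalSpace.IsTopologicalBasis B) {η ζ : FinConf d}
    (h : ∀ U ∈ B, η ∈ hitting U ↔ ζ ∈ hitting U) : η = ζ := by
  have key : ∀ {η ζ : FinConf d}, (∀ U ∈ B, η ∈ hitting U → ζ ∈ hitting U) → η.pts ⊆ ζ.pts := by
    intro η ζ h p hp
    by_contra hpζ
    obtain ⟨U, hUB, hpU, hUζ⟩ := hB.exists_subset_of_mem_open
      (show p ∈ (ζ.pts : Set (EuclideanSpace ℝ (Fin d)))ᶜ from hpζ)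
      ζ.pts.finite_toSet.isClosed.isOpen_compl
    obtain ⟨q, hq, hqU⟩ := h U hUB ⟨p, hp, hpU⟩
    exact hUζ hqU hq
  exact FinConf.ext (Finset.Subset.antisymm (key fun U hU => (h U hU).1)
    (key fun U hU => (h U hU).2))

theorem countablySeparated_of_measurableSet_hitting (m : MeasurableSpace (FinConf d))
    (hm : ∀ U : Set (EuclideanSpace ℝ (Fin d)), IsOpen U → MeasurableSet[m] (hitting U)) :
    MeasurableSpace.CountablySeparated (FinConf d) := by
  refine ⟨⟨hitting '' TopologicalSpace.countableBasis (EuclideanSpace ℝ (Fin d)),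
    (TopologicalSpace.countable_countableBasis _).image _, ?_, fun η _ ζ _ h => ?_⟩⟩
  · rintro _ ⟨U, hU, rfl⟩
    exact hm U (TopologicalSpace.isOpen_of_mem_countableBasis hU)
  · exact eq_of_forall_mem_hitting_iff (TopologicalSpace.isBasis_countableBasis _)
      fun U hU => h _ (mem_image_of_mem _ hU)

-- By Lusin–Souslin, a countably separated σ-field for which `ofSigma` is measurable is its
-- quotient σ-field, so any two such σ-fields agree.
theorem measurableSpace_eq_map_ofSigma {m : MeasurableSpace (FinConf d)}
    (hle : m ≤ borel (FinConf d))
    (hm : ∀ U : Set (EuclideanSpace ℝ (Fin d)), IsOpen U → MeasurableSet[m] (hitting U)) :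
    m = MeasurableSpace.map ofSigma inferInstance := by
  have := countablySeparated_of_measurableSet_hitting m hm
  exact ((measurable_ofSigma.mono le_rfl hle).map_measurableSpace_eq surjective_ofSigma).symm

theorem borel_eq_map_ofSigma :
    borel (FinConf d) = MeasurableSpace.map ofSigma inferInstance :=
  measurableSpace_eq_map_ofSigma le_rfl fun _ hU => (isOpen_hitting hU).measurableSet

theorem borel_eq_generateFrom_hitting :
    borel (FinConf d) = MeasurableSpace.generateFrom (hitting '' {U | IsOpen U}) := by
  refine borel_eq_map_ofSigma.trans (measurableSpace_eq_map_ofSigma ?_ fun U hU => ?_).symm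
  · refine MeasurableSpace.generateFrom_le ?_
    rintro _ ⟨U, hU, rfl⟩
    exact (isOpen_hitting hU).measurableSet
  · exact MeasurableSpace.measurableSet_generateFrom (mem_image_of_mem _ hU)

theorem measurable_of_measurableSet_hitting {Y : Type*} [MeasurableSpace Y] {f : Y → FinConf d}
    (hf : ∀ U, IsOpen U → MeasurableSet (f ⁻¹' hitting U)) : Measurable f := by
  rw [finConfMeasurableSpace, borel_eq_generateFrom_hitting]
  refine measurable_generateFrom ?_
  rintro _ ⟨U, hU, rfl⟩
  exact hf U hU

theorem measurable_of_comp_ofTuple {Y : Type*} [MeasurableSpace Y] {f : FinConf d → Y}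
    (hf : ∀ n, Measurable (f ∘ ofTuple n)) : Measurable f := by
  intro B hB
  rw [finConfMeasurableSpace, borel_eq_map_ofSigma]
  exact measurableSet_sigma_iff.2 fun n => hf n hB

theorem measurable_card : Measurable fun η : FinConf d => η.pts.card :=
  measurable_of_comp_ofTuple fun n => by
    simp only [Function.comp_def, card_pts_ofTuple, measurable_const]

theorem jump_mem_hitting {η : FinConf d} {x y : EuclideanSpace ℝ (Fin d)}
    {U : Set (EuclideanSpace ℝ (Fin d))} :
    jump η x y ∈ hitting U ↔ y ∈ U ∨ η ∈ hitting (U \ {x}) := by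
  simp only [hitting, jump, mem_ofPred_eq, Finset.mem_insert, Finset.mem_erase, Set.mem_sdiff,
    mem_singleton_iff]
  grind

theorem measurableSet_mem_hitting_diff {U : Set (EuclideanSpace ℝ (Fin d))} (hU : IsOpen U) :
    MeasurableSet {q : FinConf d × EuclideanSpace ℝ (Fin d) | q.1 ∈ hitting (U \ {q.2})} := by
  have hB := TopologicalSpace.isBasis_countableBasis (EuclideanSpace ℝ (Fin d))
  have hunion : {q : FinConf d × EuclideanSpace ℝ (Fin d) | q.1 ∈ hitting (U \ {q.2})} =
      ⋃ V ∈ TopologicalSpace.countableBasis (EuclideanSpace ℝ (Fin d)),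
        hitting (U ∩ V) ×ˢ Vᶜ := by
    ext ⟨η, x⟩
    simp only [mem_ofPred_eq, mem_iUnion, mem_prod, exists_prop, mem_compl_iff]
    constructor
    · rintro ⟨p, hp, hpU, hpx⟩
      obtain ⟨V, hV, hpV, hVx⟩ := hB.exists_subset_of_mem_open
        (show p ∈ ({x} : Set (EuclideanSpace ℝ (Fin d)))ᶜ from hpx) isOpen_compl_singleton
      exact ⟨V, hV, ⟨p, hp, hpU, hpV⟩, fun hx => hVx hx rfl⟩
    · rintro ⟨V, -, ⟨p, hp, hpU, hpV⟩, hxV⟩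
      exact ⟨p, hp, hpU, fun hpx => hxV (hpx ▸ hpV)⟩
  rw [hunion]
  refine MeasurableSet.biUnion (TopologicalSpace.countable_countableBasis _) fun V hV => ?_
  have hVo := TopologicalSpace.isOpen_of_mem_countableBasis hV
  exact (isOpen_hitting (hU.inter hVo)).measurableSet.prod hVo.measurableSet.compl

theorem measurable_jump : Measurable fun q : FinConf d × EuclideanSpace ℝ (Fin d) ×
    EuclideanSpace ℝ (Fin d) => jump q.1 q.2.1 q.2.2 := by
  refine measurable_of_measurableSet_hitting fun U hU => ?_
  simp only [preimage, jump_mem_hitting]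
  exact (measurable_snd.snd hU.measurableSet).union
    ((measurable_fst.prodMk measurable_snd.fst) (measurableSet_mem_hitting_diff hU))

theorem card_jump {η : FinConf d} {x y : EuclideanSpace ℝ (Fin d)} (hx : x ∈ η.pts)
    (hy : y = x ∨ y ∉ η.pts) : (jump η x y).pts.card = η.pts.card := by
  classical
  have hy' : y ∉ η.pts.erase x := fun h =>
    hy.elim (Finset.ne_of_mem_erase h) fun hyη => hyη (Finset.mem_of_mem_erase h)
  rw [← Finset.card_erase_add_one hx, ← Finset.card_insert_of_notMem hy', jump]

end Configurations

section JumpKernel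

variable {d : ℕ} {a φ : EuclideanSpace ℝ (Fin d) → ℝ}

/-- The density of the rate at which the particle of `η` at `x` jumps to `y`. -/
def jumpRate (a φ : EuclideanSpace ℝ (Fin d) → ℝ) (η : FinConf d)
    (x y : EuclideanSpace ℝ (Fin d)) : ℝ :=
  a (x - y) * Real.exp (-energy φ y η)

/-- The measure `Ω(·, η)`. -/
def jumpMeasure (a φ : EuclideanSpace ℝ (Fin d) → ℝ) (η : FinConf d) : Measure (FinConf d) :=
  ∑ x ∈ η.pts, (volume.withDensity fun y => ENNReal.ofReal (jumpRate a φ η x y)).map (jump η x)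

theorem measurable_jump_right (η : FinConf d) (x : EuclideanSpace ℝ (Fin d)) :
    Measurable (jump η x) :=
  measurable_jump.comp (measurable_const.prodMk (measurable_const.prodMk measurable_id))

theorem measurable_coord {n : ℕ} (i : Fin n) :
    Measurable fun p : InjTuple d n × EuclideanSpace ℝ (Fin d) => p.1.1 i :=
  (measurable_pi_apply i).comp (measurable_subtype_coe.comp measurable_fst)

theorem measurable_jumpRate_ofTuple (ha : Measurable a) (hφ : Measurable φ) {n : ℕ} (i : Fin n) :
    Measurable fun p : InjTuple d n × EuclideanSpace ℝ (Fin d) =>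
      jumpRate a φ (ofTuple n p.1) (p.1.1 i) p.2 := by
  simp only [jumpRate, energy, sum_pts_ofTuple]
  exact (ha.comp ((measurable_coord i).sub measurable_snd)).mul
    (Finset.measurable_fun_sum _ fun j _ =>
      hφ.comp (measurable_snd.sub (measurable_coord j))).neg.exp

theorem measurable_jumpRate (ha : Measurable a) (hφ : Measurable φ) (η : FinConf d)
    (x : EuclideanSpace ℝ (Fin d)) : Measurable (jumpRate a φ η x) := by
  unfold jumpRate energy
  fun_prop

theorem jumpMeasure_apply (η : FinConf d) {A : Set (FinConf d)} (hA : MeasurableSet A) :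
    jumpMeasure a φ η A =
      ∑ x ∈ η.pts, ∫⁻ y in jump η x ⁻¹' A, ENNReal.ofReal (jumpRate a φ η x y) := by
  rw [jumpMeasure, Measure.finsetSum_apply]
  refine Finset.sum_congr rfl fun x _ => ?_
  rw [Measure.map_apply (measurable_jump_right η x) hA,
    withDensity_apply _ (measurable_jump_right η x hA)]

theorem measurable_jumpMeasure (ha : Measurable a) (hφ : Measurable φ) :
    Measurable (jumpMeasure a φ) := by
  refine Measure.measurable_of_measurable_coe _ fun A hA => measurable_of_comp_ofTuple fun n => ?_
  simp only [Function.comp_def, jumpMeasure_apply _ hA, sum_pts_ofTuple,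
    ← lintegral_indicator (measurable_jump_right _ _ hA)]
  refine Finset.measurable_fun_sum _ fun i _ => Measurable.lintegral_prod_right' (f := fun
    p : InjTuple d n × EuclideanSpace ℝ (Fin d) => (jump (ofTuple n p.1) (p.1.1 i) ⁻¹' A).indicator
      (fun y => ENNReal.ofReal (jumpRate a φ (ofTuple n p.1) (p.1.1 i) y)) p.2) ?_
  have hjump : Measurable fun p : InjTuple d n × EuclideanSpace ℝ (Fin d) =>
      jump (ofTuple n p.1) (p.1.1 i) p.2 :=
    measurable_jump.comp (((continuous_ofTuple n).measurable.comp measurable_fst).prodMk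
      ((measurable_coord i).prodMk measurable_snd))
  exact (measurable_jumpRate_ofTuple ha hφ i).ennreal_ofReal.indicator (hjump hA)

/-- The jump kernel `Ω` of the Kawasaki dynamics. -/
def jumpKernel (ha : Measurable a) (hφ : Measurable φ) : Kernel (FinConf d) (FinConf d) where
  toFun := jumpMeasure a φ
  measurable' := measurable_jumpMeasure ha hφ

theorem jumpKernel_apply (ha : Measurable a) (hφ : Measurable φ) (η : FinConf d) :
    jumpKernel ha hφ η = jumpMeasure a φ η := rfl

theorem jumpRate_nonneg (ha0 : ∀ x, 0 ≤ a x) (η : FinConf d) (x y : EuclideanSpace ℝ (Fin d)) :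
    0 ≤ jumpRate a φ η x y :=
  mul_nonneg (ha0 _) (Real.exp_pos _).le

variable {c : ℝ}

theorem jumpRate_le (ha0 : ∀ x, 0 ≤ a x) (hc : ∀ x, c ≤ φ x) (η : FinConf d)
    (x y : EuclideanSpace ℝ (Fin d)) :
    jumpRate a φ η x y ≤ a (x - y) * Real.exp (-(η.pts.card • c)) := by
  have henergy : η.pts.card • c ≤ energy φ y η := Finset.card_nsmul_le_sum _ _ _ fun _ _ => hc _
  rw [jumpRate]
  gcongr
  exact ha0 _

theorem integrable_jumpRate (ha : Measurable a) (ha0 : ∀ x, 0 ≤ a x) (ha_int : Integrable a)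
    (hφ : Measurable φ) (hc : ∀ x, c ≤ φ x) (η : FinConf d) (x : EuclideanSpace ℝ (Fin d)) :
    Integrable (jumpRate a φ η x) := by
  refine ((ha_int.comp_sub_left x).mul_const (Real.exp (-(η.pts.card • c)))).mono'
    (measurable_jumpRate ha hφ η x).aestronglyMeasurable (Eventually.of_forall fun y => ?_)
  rw [Real.norm_of_nonneg (jumpRate_nonneg ha0 η x y)]
  exact jumpRate_le ha0 hc η x y

theorem jumpMeasure_univ_le (ha0 : ∀ x, 0 ≤ a x) (hc : ∀ x, c ≤ φ x) (η : FinConf d) :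
    jumpMeasure a φ η univ ≤
      η.pts.card • ∫⁻ x, ENNReal.ofReal (a x * Real.exp (-(η.pts.card • c))) := by
  rw [jumpMeasure_apply η MeasurableSet.univ]
  refine Finset.sum_le_card_nsmul _ _ _ fun x _ => ?_
  rw [preimage_univ, Measure.restrict_univ]
  calc ∫⁻ y, ENNReal.ofReal (jumpRate a φ η x y)
      ≤ ∫⁻ y, ENNReal.ofReal (a (x - y) * Real.exp (-(η.pts.card • c))) :=
        lintegral_mono fun y => ENNReal.ofReal_le_ofReal (jumpRate_le ha0 hc η x y)
    _ = ∫⁻ y, ENNReal.ofReal (a y * Real.exp (-(η.pts.card • c))) :=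
        lintegral_sub_left_eq_self (fun y => ENNReal.ofReal (a y * _)) x

theorem ae_jumpMeasure_card_eq (η : FinConf d) :
    ∀ᵐ ζ ∂jumpMeasure a φ η, ζ.pts.card = η.pts.card := by
  refine ae_finsetSum_measure_iff.2 fun x hx => ?_
  have hjump : ∀ᵐ y, (jump η x y).pts.card = η.pts.card := by
    rcases subsingleton_or_nontrivial (EuclideanSpace ℝ (Fin d)) with _ | _
    · exact Eventually.of_forall fun y => card_jump hx (.inl (Subsingleton.elim y x))
    · filter_upwards [measure_eq_zero_iff_ae_notMem.1 (η.pts.finite_toSet.measure_zero volume)]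
        with y hy
      exact card_jump hx (.inr hy)
  refine (ae_map_iff (measurable_jump_right η x).aemeasurable
    (measurable_card (measurableSet_singleton _))).2 ?_
  exact (withDensity_absolutelyContinuous _ _).ae_le hjump

theorem isConservative_jumpKernel (ha : Measurable a) (ha0 : ∀ x, 0 ≤ a x)
    (ha_int : Integrable a) (hφ : Measurable φ) (hφ_bdd : BddBelow (range φ)) :
    IsConservative (jumpKernel ha hφ) fun η => η.pts.card where
  measurable_charge := measurable_card
  exists_mass_le n := by
    obtain ⟨c, hc⟩ := hφ_bdd
    obtain ⟨C, hC⟩ : ∃ C : ℝ≥0, n • ∫⁻ x, ENNReal.ofReal (a x * Real.exp (-(n • c))) = C := by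
      refine ⟨_, (ENNReal.coe_toNNReal ?_).symm⟩
      rw [nsmul_eq_mul]
      exact ENNReal.mul_ne_top (ENNReal.natCast_ne_top n) (ha_int.mul_const _).lintegral_lt_top.ne
    refine ⟨C, fun η hη => ?_⟩
    rw [← hC, ← hη]
    exact jumpMeasure_univ_le ha0 (fun x => hc (mem_range_self x)) η
  ae_charge_eq := ae_jumpMeasure_card_eq

theorem measureReal_jumpKernel (ha : Measurable a) (ha0 : ∀ x, 0 ≤ a x)
    (ha_int : Integrable a) (hφ : Measurable φ) (hφ_bdd : BddBelow (range φ))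
    {A : Set (FinConf d)} (hA : MeasurableSet A) (η : FinConf d) :
    (jumpKernel ha hφ η).real A = Omega a φ A η := by
  obtain ⟨c, hc⟩ := hφ_bdd
  have hint (x) := integrable_jumpRate ha ha0 ha_int hφ (fun x => hc (mem_range_self x)) η x
  rw [measureReal_def, jumpKernel_apply, jumpMeasure_apply η hA, Omega,
    ENNReal.toReal_sum fun x _ => ((hint x).integrableOn.lintegral_lt_top).ne]
  refine Finset.sum_congr rfl fun x _ => ?_
  rw [← integral_eq_lintegral_of_nonneg_ae (Eventually.of_forall (jumpRate_nonneg ha0 η x))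
    (hint x).aestronglyMeasurable.restrict,
    ← integral_indicator (measurable_jump_right η x hA)]
  refine integral_congr_ae (Eventually.of_forall fun y => ?_)
  by_cases hy : jump η x y ∈ A <;> simp [hy, jumpRate]

theorem graphLstar_eq_jumpGraph (ha : Measurable a) (ha0 : ∀ x, 0 ≤ a x)
    (ha_int : Integrable a) (hφ : Measurable φ) (hφ_bdd : BddBelow (range φ)) :
    graphLstar a φ = jumpGraph (jumpKernel ha hφ) := by
  have hreal {A : Set (FinConf d)} (hA : MeasurableSet A) :
      (fun η => (jumpKernel ha hφ η).real A) = Omega a φ A :=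
    funext (measureReal_jumpKernel ha ha0 ha_int hφ hφ_bdd hA)
  have := (isConservative_jumpKernel ha ha0 ha_int hφ hφ_bdd).isFiniteMeasure
  ext ⟨μ, ν⟩
  rw [graphLstar, jumpGraph, mem_ofPred_eq, mem_ofPred_eq, domLstar, mem_ofPred_eq,
    hreal MeasurableSet.univ]
  refine and_congr_right fun hμ => forall₂_congr fun A hA => ?_
  have hA_int : μ.Integrable (Omega a φ A) :=
    hreal hA ▸ integrable_measureReal_kernel _ ((hreal MeasurableSet.univ).symm ▸ hμ) hA
  have hloss : μ.Integrable fun η => Omega a φ univ η * A.indicator (fun _ => (1 : ℝ)) η := by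
    refine (hμ.indicator hA).congr (Eventually.of_forall fun η => ?_)
    by_cases hη : η ∈ A <;> simp [hη]
  unfold generatorIndicator
  simp only [funext_iff.1 (hreal hA), funext_iff.1 (hreal MeasurableSet.univ)]
  rw [VectorMeasure.integral_fun_sub hA_int hloss, neg_add_eq_sub]

end JumpKernel

end Kawasaki
end

theorem theorem3p3_general (d : ℕ) (a φ : EuclideanSpace ℝ (Fin d) → ℝ)
    (ha_meas : Measurable a) (ha_nonneg : ∀ x, 0 ≤ a x) (ha_int : Integrable a)
    (hφ_meas : Measurable φ) (hφ_bdd : BddBelow (range φ)) :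
    (∀ μ ∈ Kawasaki.domLstar a φ, ∃! ν, (μ, ν) ∈ Kawasaki.graphLstar a φ) ∧
    ∃ S : ℝ≥0 → SignedMeasure (Kawasaki.FinConf d) →L[ℝ] SignedMeasure (Kawasaki.FinConf d),
      Kawasaki.IsStochasticSemigroup S ∧
      Kawasaki.generatorGraph S = closure (Kawasaki.graphLstar a φ) ∧
      (∀ (P : Measure (Kawasaki.FinConf d)) [IsProbabilityMeasure P],
        (∀ t, 0 ≤ S t P.toSignedMeasure ∧ S t P.toSignedMeasure univ = 1) ∧
        Kawasaki.IsMildSolution (closure (Kawasaki.graphLstar a φ)) P.toSignedMeasure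
          (fun t => S t.toNNReal P.toSignedMeasure) ∧
        (∀ u, Kawasaki.IsMildSolution (closure (Kawasaki.graphLstar a φ)) P.toSignedMeasure u →
          ∀ t : ℝ≥0, u t = S t P.toSignedMeasure) ∧
        ((∃ ν, (P.toSignedMeasure, ν) ∈ closure (Kawasaki.graphLstar a φ)) →
          Kawasaki.IsClassicalSolution (closure (Kawasaki.graphLstar a φ)) P.toSignedMeasure
            (fun t => S t.toNNReal P.toSignedMeasure)) ∧
        (∀ u, Kawasaki.IsClassicalSolution (closure (Kawasaki.graphLstar a φ))
            P.toSignedMeasure u →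
          ∀ t : ℝ≥0, u t = S t P.toSignedMeasure)) ∧
      (∀ (δ : ℕ → ℝ≥0) (ε : ℝ), 0 < ε →
        (∀ η : Kawasaki.FinConf d, ε * Kawasaki.Omega a φ univ η ≤ δ η.pts.card) →
        (∀ t, ∀ μ ∈ Kawasaki.coneMb (fun η : Kawasaki.FinConf d => (δ η.pts.card : ℝ)),
          S t μ ∈ Kawasaki.coneMb (fun η : Kawasaki.FinConf d => (δ η.pts.card : ℝ))) ∧
        (∀ (P : Measure (Kawasaki.FinConf d)) [IsProbabilityMeasure P],
          P.toSignedMeasure ∈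
            Kawasaki.coneMb (fun η : Kawasaki.FinConf d => (δ η.pts.card : ℝ)) →
          Kawasaki.IsClassicalSolution (Kawasaki.graphLstar a φ) P.toSignedMeasure
            (fun t => S t.toNNReal P.toSignedMeasure))) := by
  have h := Kawasaki.isConservative_jumpKernel ha_meas ha_nonneg ha_int hφ_meas hφ_bdd
  have hΩ := Kawasaki.measureReal_jumpKernel ha_meas ha_nonneg ha_int hφ_meas hφ_bdd .univ
  rw [Kawasaki.graphLstar_eq_jumpGraph ha_meas ha_nonneg ha_int hφ_meas hφ_bdd]
  refine ⟨fun μ hμ => h.existsUnique_mem_jumpGraph (by simp only [hΩ]; exact hμ), h.semigroup,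
    h.isStochasticSemigroup, h.generatorGraph_semigroup, fun P _ => ⟨fun t => ⟨?_, ?_⟩,
      h.isMildSolution _, fun _ hu => h.eq_semigroup_of_isMildSolution hu,
      fun ⟨_, hν⟩ => h.isClassicalSolution_closure hν,
      fun _ hu => h.eq_semigroup_of_isClassicalSolution hu⟩,
    fun δ ε hε hδ => ⟨fun t μ hμ => ⟨h.semigroup_nonneg t hμ.1,
      h.integrable_comp_charge_semigroup (g := fun n => δ n) t hμ.1 hμ.2⟩,
      fun P _ hP => h.isClassicalSolution (g := fun n => δ n) hP.1 hP.2 hε ?_⟩⟩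
  · exact h.semigroup_nonneg t (Measure.zero_le_toSignedMeasure P)
  · rw [h.semigroup_apply_univ, Measure.toSignedMeasure_apply_measurable .univ, probReal_univ]
  · simpa only [hΩ] using hδ

theorem theorem3p3 (d : ℕ) (hd : 0 < d) (a φ : EuclideanSpace ℝ (Fin d) → ℝ)
    (ha_meas : Measurable a) (ha_nonneg : ∀ x, 0 ≤ a x) (ha_symm : ∀ x, a (-x) = a x)
    (ha_int : Integrable a)
    (hφ_meas : Measurable φ) (hφ_nonneg : ∀ x, 0 ≤ φ x) (hφ_symm : ∀ x, φ (-x) = φ x)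
    (hφ_int : Integrable (fun x => 1 - Real.exp (-φ x))) :
    -- `L*` is an operator with the given domain
    (∀ μ ∈ Kawasaki.domLstar a φ, ∃! ν, (μ, ν) ∈ Kawasaki.graphLstar a φ) ∧
    -- the closure of `L*` generates a stochastic semigroup `S`
    ∃ S : ℝ≥0 → SignedMeasure (Kawasaki.FinConf d) →L[ℝ] SignedMeasure (Kawasaki.FinConf d),
      Kawasaki.IsStochasticSemigroup S ∧
      Kawasaki.generatorGraph S = closure (Kawasaki.graphLstar a φ) ∧
      -- well-posedness of the Fokker-Planck equation for all states on `Γ₀`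
      (∀ (P : Measure (Kawasaki.FinConf d)) [IsProbabilityMeasure P],
        (∀ t, 0 ≤ S t P.toSignedMeasure ∧ S t P.toSignedMeasure univ = 1) ∧
        Kawasaki.IsMildSolution (closure (Kawasaki.graphLstar a φ)) P.toSignedMeasure
          (fun t => S t.toNNReal P.toSignedMeasure) ∧
        (∀ u, Kawasaki.IsMildSolution (closure (Kawasaki.graphLstar a φ)) P.toSignedMeasure u →
          ∀ t : ℝ≥0, u t = S t P.toSignedMeasure) ∧
        ((∃ ν, (P.toSignedMeasure, ν) ∈ closure (Kawasaki.graphLstar a φ)) →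
          Kawasaki.IsClassicalSolution (closure (Kawasaki.graphLstar a φ)) P.toSignedMeasure
            (fun t => S t.toNNReal P.toSignedMeasure)) ∧
        (∀ u, Kawasaki.IsClassicalSolution (closure (Kawasaki.graphLstar a φ))
            P.toSignedMeasure u →
          ∀ t : ℝ≥0, u t = S t P.toSignedMeasure)) ∧
      -- the cones `M_{b,+}`, where `b(η) = δ(|η|) ≥ ε Ω(Γ₀, η)`
      (∀ (δ : ℕ → ℝ≥0) (ε : ℝ), 0 < ε →
        (∀ η : Kawasaki.FinConf d, ε * Kawasaki.Omega a φ univ η ≤ δ η.pts.card) →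
        (∀ t, ∀ μ ∈ Kawasaki.coneMb (fun η : Kawasaki.FinConf d => (δ η.pts.card : ℝ)),
          S t μ ∈ Kawasaki.coneMb (fun η : Kawasaki.FinConf d => (δ η.pts.card : ℝ))) ∧
        (∀ (P : Measure (Kawasaki.FinConf d)) [IsProbabilityMeasure P],
          P.toSignedMeasure ∈
            Kawasaki.coneMb (fun η : Kawasaki.FinConf d => (δ η.pts.card : ℝ)) →
          Kawasaki.IsClassicalSolution (Kawasaki.graphLstar a φ) P.toSignedMeasure
            (fun t => S t.toNNReal P.toSignedMeasure))) := by
  exact theorem3p3_general d a φ ha_meas ha_nonneg ha_int hφ_meas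
    ⟨0, forall_mem_range.2 hφ_nonneg⟩
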